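/- For $n\ge 3$ let $\mathbb{R}^{\binom{[n]}{2}}$ be the Euclidean space of real vectors indexed by the unordered pairs $ij$, $1\le i\ne j\le n$, let $$\mathcal{M}_n=\Big\{d\in[0,1]^{\binom{[n]}{2}} : d_{ij}+d_{jk}\ge d_{ik}\ \text{ for all distinct } i,j,k\Big\},$$ and let $\mathbf{B}$ be the closed unit ball of $\mathbb{R}^{\binom{[n]}{2}}$. An ellipsoid is a set $A\mathbf{B}+c$ with $A$ a positive semidefinite matrix and $c$ a vector (its center); $r\mathcal{E}$ denotes $\mathcal{E}$ inflated by the factor $r>0$ about its center. For every $n\ge3$ the unique largest-volume ellipsoid contained in $\mathcal{M}_n$ is $\mathcal{E}_n=A_n\mathbf{B}+c_n$, where $c_n$ is the vector all of whose coordinates equal $\delta_n$ and $A_n$ is the positive semidefinite $\binom n2\times\binom n2$ matrix with $$[A_n]_{ij,kl}=\begin{cases}\alpha_n & ij=kl,\\ \beta_n & |\{i,j\}\cap\{k,l\}|=1,\\ \gamma_n & \{i,j\}\cap\{k,l\}=\emptyset,\end{cases}$$ for real numbers $\alpha_n,\beta_n,\gamma_n,\delta_n$ that satisfy, as $n\to\infty$,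 $$\begin{aligned} \alpha_n&=\tfrac{\sqrt3-1}{2}+o(1)&&\approx 0.3660+o(1),\\ \beta_n&=\tfrac{\sqrt3-1}{2}\big(\sqrt{3-\sqrt3}-1\big)\tfrac1n+o\big(\tfrac1n\big)&&\approx 0.0461\cdot\tfrac1n+o\big(\tfrac1n\big),\\ \gamma_n&=\tfrac{\sqrt3-1}{2}\big(2\sqrt[4]{3}+2-4\sqrt{3-\sqrt3}\big)\tfrac1{n^2}+o\big(\tfrac1{n^2}\big)&&\approx 0.0469\cdot\tfrac1{n^2}+o\big(\tfrac1{n^2}\big),\\ \delta_n&=\tfrac{\sqrt3-1}{2}\sqrt3+o(1)&&\approx 0.6340+o(1). \end{aligned}$$ Moreover, for every $n\ge 3$ there is a smallest $r=r_n>0$ with $\mathcal{E}_n\subseteq\mathcal{M}_n\subseteq r\,\mathcal{E}_n$, and $$\frac{3^{3/4}\sqrt{5+\sqrt3}}{6}\,n+o(n)\ \le\ r_n\ \le\ \sqrt{3\tbinom n2}+o(n),$$ where $\frac{3^{3/4}\sqrt{5+\sqrt3}}{6}\approx0.99$ and $\sqrt{3\binom n2}=\sqrt{3/2}\,n+o(n)\approx1.22\,n+o(n)$.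 (Here $\approx$ between numbers means agreement up to rounding to the displayed digits.) -/

import Mathlib

open Filter Asymptotics

/-- The unordered pairs `ij` with `i ≠ j` in `[n]`, i.e. the two-element subsets of `[n]`. -/
abbrev Pairs (n : ℕ) : Type := {s : Finset (Fin n) // s.card = 2}

/-- The unordered pair `ij` of two distinct elements. -/
def mkPair {n : ℕ} {i j : Fin n} (h : i ≠ j) : Pairs n := ⟨{i, j}, Finset.card_pair h⟩

/-- The space of real vectors indexed by the unordered pairs in `[n]`, with its Euclidean norm. -/
abbrev PairSpace (n : ℕ) : Type := EuclideanSpace ℝ (Pairs n)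

/-- The metric cone: all `n`-point (semi)metrics. -/
def metricCone (n : ℕ) : Set (PairSpace n) :=
  {d | ∀ (i j k : Fin n) (hij : i ≠ j) (hjk : j ≠ k) (hik : i ≠ k),
    0 ≤ d (mkPair hij) ∧ 0 ≤ d (mkPair hij) + d (mkPair hjk) - d (mkPair hik)}

/-- The metric polytope: the metric cone intersected with the cube `[0, 1]`. -/
def metricPolytope (n : ℕ) : Set (PairSpace n) :=
  metricCone n ∩ {d | ∀ p : Pairs n, d p ∈ Set.Icc (0 : ℝ) 1}

section Ellipsoids

variable {ι : Type*} [Fintype ι] [DecidableEq ι]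

/-- The set `A B + c`, where `B` is the closed Euclidean unit ball. -/
def affineBall (A : Matrix ι ι ℝ) (c : EuclideanSpace ℝ ι) : Set (EuclideanSpace ℝ ι) :=
  (fun u => A.toEuclideanLin u + c) '' Metric.closedBall (0 : EuclideanSpace ℝ ι) 1

/-- An ellipsoid is a set `A B + c` with `A` positive semidefinite. -/
def IsEllipsoid (E : Set (EuclideanSpace ℝ ι)) : Prop :=
  ∃ (A : Matrix ι ι ℝ) (c : EuclideanSpace ℝ ι), A.PosSemidef ∧ E = affineBall A c

/-- `E` is the (unique) ellipsoid of largest volume contained in `K`: it is an ellipsoid contained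
in `K`, and every other ellipsoid contained in `K` has strictly smaller volume. -/
def IsLargestEllipsoidIn (E K : Set (EuclideanSpace ℝ ι)) : Prop :=
  IsEllipsoid E ∧ E ⊆ K ∧
    ∀ F : Set (EuclideanSpace ℝ ι), IsEllipsoid F → F ⊆ K → F ≠ E →
      MeasureTheory.volume F < MeasureTheory.volume E

/-- The set `E` inflated by the factor `t` about the point `c`. -/
def inflate (c : EuclideanSpace ℝ ι) (t : ℝ) (E : Set (EuclideanSpace ℝ ι)) :
    Set (EuclideanSpace ℝ ι) :=
  AffineMap.homothety c t '' E

end Ellipsoids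

/-- The matrix indexed by unordered pairs, with entry `α` if the two pairs are equal, `β` if they
share exactly one element and `γ` if they are disjoint. -/
def pairMatrix (n : ℕ) (α β γ : ℝ) : Matrix (Pairs n) (Pairs n) ℝ :=
  Matrix.of fun p q => if p = q then α else if (p.1 ∩ q.1).card = 1 then β else γ

/-- The vector all of whose coordinates are `δ`. -/
def constVec (n : ℕ) (δ : ℝ) : PairSpace n := WithLp.toLp 2 fun _ => δ

/-!
The metric polytope is invariant under permutations of `[n]`, so its largest ellipsoid `A 𝐁 + c`
has `c` constant and `A` in the Bose–Mesner algebra of the Johnson scheme `J(n, 2)`, the span of the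
matrices that depend only on `|p ∩ q|`. This algebra is commutative with three common eigenspaces;
`johnson n l₀ l₁ l₂` is its element with the given eigenvalues, and `johnson_mul` makes all
computations with square roots and inverses scalar.

For `n ≥ 3` the polytope is cut out by the constraints `d_p ≤ 1` and the triangle inequalities
`⟪t, d⟫ ≥ 0`, with `t = e_ij + e_jk - e_ik`. John's optimality condition asks that `A⁻¹` be a
combination of the `a (A a)ᵀ` over the active normals `a`. As the coordinate vectors `e_p` give the
identity and the triangle normals give a matrix with eigenvalues proportional to `n - 2`, `2n - 2`,
`3n - 4`, the condition is `A⁻² = p I + q ∑ t tᵀ` (`optInvSq_eq`). With `δ = 1 / (1 + κ)`, both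
families of constraints are tight (`norm_optMatrix_pairVec`, `norm_optMatrix_triVec`) as soon as `κ`
is the zero of the strictly decreasing function `ratioFun n`, which exists in `[1/3, 1]`.

Optimality and uniqueness (`isLargestEllipsoidIn_optMatrix`): if `B 𝐁 + c'` lies in the polytope, the
constraints, paired with `A a` by Cauchy–Schwarz and summed with the multipliers, give
`tr (A⁻¹ B) ≤ dim` (`trace_le_of_affineBall_subset`). By the inequality of arithmetic and geometric
means for the eigenvalues of `A^(-1/2) B A^(-1/2)`, `det B ≥ det A` then forces `B = A`
(`eq_of_trace_le_of_det_le`), and the constraints force `c' = c`.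

As `n → ∞`, `ratioFun n κ = 0` becomes `1 / (1 + 3κ) = κ / (1 + κ)`, so `κ → 1 / √3`
(`tendsto_ratio`), and the limits of the eigenvalues and of the entries follow.

The least inflation factor is the maximum over the polytope of the gauge `‖A⁻¹ (x - c)‖`, whose square
is an explicit quadratic form in the coordinates and the triangle slacks `s` (`optGauge_sq`). The
bounds `x_p² ≤ x_p` and `s² ≤ 2 s` give at most `3 n (n - 1) / 2` for `κ ∈ [1/3, 1]`
(`optGauge_sq_le`). They are equalities for cut semimetrics, so a balanced cut yields the lower bound
(`optGauge_cutVec`).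
-/

open Matrix

/-! ### Pairs, triangles and their outer products -/

section Counting

variable {n : ℕ}

/-- The coordinate vector of the pair `ij`; it is zero when `i = j`. -/
def pairVec (i j : Fin n) : Pairs n → ℝ := fun p => if p.1 = {i, j} then 1 else 0

/-- The normal vector `e_ij + e_jk - e_ik` of the triangle inequality `d_ik ≤ d_ij + d_jk`. It
vanishes when `j ∈ {i, k}`. -/
def triVec (i j k : Fin n) : Pairs n → ℝ := pairVec i j + pairVec j k - pairVec i k

/-- The vertex-edge incidence matrix of the complete graph on `[n]`. -/
def incidence (n : ℕ) : Matrix (Fin n) (Pairs n) ℝ :=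
  Matrix.of fun i p => if i ∈ p.1 then 1 else 0

/-- The matrix with entries `|p ∩ q|`, the Gram matrix of the incidence matrix. -/
def interMatrix (n : ℕ) : Matrix (Pairs n) (Pairs n) ℝ := (incidence n)ᵀ * incidence n

/-- The all-ones matrix. -/
def onesMatrix (n : ℕ) : Matrix (Pairs n) (Pairs n) ℝ := Matrix.of fun _ _ => 1

lemma exists_eq_mkPair (p : Pairs n) : ∃ (i j : Fin n) (h : i ≠ j), p = mkPair h := by
  obtain ⟨i, j, h, e⟩ := Finset.card_eq_two.1 p.2
  exact ⟨i, j, h, Subtype.ext e⟩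

lemma pairVec_comm (i j : Fin n) : pairVec i j = pairVec j i := by
  funext p; simp [pairVec, Finset.pair_comm]

@[simp] lemma pairVec_self (i : Fin n) : pairVec i i = 0 := by
  funext p
  have : p.1 ≠ {i, i} := fun h => by have := p.2; rw [h] at this; simp at this
  exact if_neg this

lemma pairVec_eq_single {i j : Fin n} (h : i ≠ j) : pairVec i j = Pi.single (mkPair h) 1 := by
  funext p
  simp [pairVec, Pi.single_apply, mkPair, Subtype.ext_iff]

lemma triVec_left (i k : Fin n) : triVec i i k = 0 := by simp [triVec]

lemma triVec_right (i k : Fin n) : triVec i k k = 0 := by simp [triVec]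

lemma triVec_outer (i j : Fin n) : triVec i j i = (2 : ℝ) • pairVec i j := by
  rw [triVec, pairVec_comm j i, pairVec_self, two_smul, sub_zero]

lemma sum_pairVec (i : Fin n) (p : Pairs n) : ∑ j, pairVec i j p = incidence n i p := by
  obtain ⟨a, b, h, rfl⟩ := exists_eq_mkPair p
  have key : ∀ j, ((({a, b} : Finset (Fin n)) = {i, j}) ↔ (a = i ∧ j = b) ∨ (b = i ∧ j = a)) := by
    intro j
    rw [← Finset.coe_inj]
    push_cast
    rw [Set.pair_eq_pair_iff]
    constructor <;> rintro (⟨h1, h2⟩ | ⟨h1, h2⟩) <;> simp [h1, h2]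
  simp only [pairVec, incidence, mkPair, Matrix.of_apply, key]
  by_cases ha : a = i
  · have hb : b ≠ i := fun hb => h (ha.trans hb.symm)
    simp only [ha, hb, true_and, false_and, or_false]
    simp
  · by_cases hb : b = i
    · simp [ha, hb]
    · simp [ha, hb, Ne.symm ha, Ne.symm hb, eq_comm]

lemma sum_incidence (p : Pairs n) : ∑ i, incidence n i p = 2 := by
  simp [incidence, p.2]

lemma sum_sum_pairVec (p : Pairs n) : ∑ i : Fin n, ∑ j, pairVec i j p = 2 := by
  simp only [sum_pairVec, sum_incidence]

lemma sum_vecMulVec_pairVec :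
    ∑ i : Fin n, ∑ j, vecMulVec (pairVec i j) (pairVec i j) =
      (2 : ℝ) • (1 : Matrix (Pairs n) (Pairs n) ℝ) := by
  ext p q
  simp only [Matrix.sum_apply, vecMulVec_apply, Matrix.smul_apply, Matrix.one_apply]
  by_cases h : p = q
  · subst h
    simp only [if_true, smul_eq_mul, mul_one]
    rw [← sum_sum_pairVec p]
    refine Finset.sum_congr rfl fun i _ => Finset.sum_congr rfl fun j _ => ?_
    simp [pairVec]
  · simp only [h, if_false, smul_zero]
    refine Finset.sum_eq_zero fun i _ => Finset.sum_eq_zero fun j _ => ?_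
    by_cases h1 : p.1 = {i, j}
    · have h2 : q.1 ≠ {i, j} := fun h2 => h (Subtype.ext (h1.trans h2.symm))
      simp [pairVec, h2]
    · simp [pairVec, h1]

/-- The triples `(i, j, k)` that index triangle inequalities. Those with `j ∈ {i, k}` are kept,
since their vector `triVec i j k` is zero, while `i = k` would give twice a coordinate vector. -/
def triples (n : ℕ) : Finset (Fin n × Fin n × Fin n) := {x | x.1 ≠ x.2.2}

lemma sum_triples {M : Type*} [AddCommGroup M] (f : Fin n → Fin n → Fin n → M) :
    ∑ x ∈ triples n, f x.1 x.2.1 x.2.2 = ∑ i, ∑ j, ∑ k, f i j k - ∑ i, ∑ j, f i j i := by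
  rw [triples, Finset.sum_filter, Fintype.sum_prod_type, ← Finset.sum_sub_distrib]
  refine Finset.sum_congr rfl fun i _ => ?_
  rw [Fintype.sum_prod_type, ← Finset.sum_sub_distrib]
  refine Finset.sum_congr rfl fun j _ => ?_
  rw [eq_sub_iff_add_eq, ← Finset.sum_erase_add _ _ (Finset.mem_univ i),
    ← Finset.sum_erase_add (a := i) _ (f i j) (Finset.mem_univ i)]
  simp only [ne_eq, not_true_eq_false, if_false, add_zero]
  congr 1
  refine Finset.sum_congr rfl fun k hk => ?_
  simp [(Finset.ne_of_mem_erase hk).symm]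

lemma sum_triVec (p : Pairs n) :
    ∑ x ∈ triples n, triVec x.1 x.2.1 x.2.2 p = 2 * (n : ℝ) - 4 := by
  rw [sum_triples fun i j k => triVec i j k p]
  have h1 : ∑ i : Fin n, ∑ j, ∑ _k : Fin n, pairVec i j p = (n : ℝ) * 2 := by
    simp [← sum_sum_pairVec p, Finset.mul_sum]
  have h2 : ∑ _i : Fin n, ∑ j : Fin n, ∑ k, pairVec j k p = (n : ℝ) * 2 := by
    simp [sum_sum_pairVec]
  have h3 : ∑ i : Fin n, ∑ _j : Fin n, ∑ k, pairVec i k p = (n : ℝ) * 2 := by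
    simp [← sum_sum_pairVec p, Finset.mul_sum]
  simp only [triVec_outer]
  simp only [triVec, Pi.add_apply, Pi.sub_apply, Pi.smul_apply, smul_eq_mul,
    Finset.sum_add_distrib, Finset.sum_sub_distrib, ← Finset.mul_sum, h1, h2, h3]
  rw [sum_sum_pairVec]
  ring

/-- Each pair lies in `n - 2` triangles, and two pairs sharing a point lie in exactly one. -/
lemma sum_vecMulVec_triVec :
    ∑ x ∈ triples n, vecMulVec (triVec x.1 x.2.1 x.2.2) (triVec x.1 x.2.1 x.2.2) =
      (2 : ℝ) • ((3 * (n : ℝ) - 4) • (1 : Matrix (Pairs n) (Pairs n) ℝ) - interMatrix n) := by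
  rw [sum_triples fun i j k => vecMulVec (triVec i j k) (triVec i j k)]
  ext p q
  have hG : interMatrix n p q = ∑ i, (∑ j, pairVec i j p) * ∑ k, pairVec i k q := by
    simp [interMatrix, Matrix.mul_apply, sum_pairVec]
  have hI := congrFun (congrFun (sum_vecMulVec_pairVec (n := n)) p) q
  simp only [Matrix.sum_apply, vecMulVec_apply] at hI
  have e1 : ∑ i : Fin n, ∑ j, ∑ _k : Fin n, pairVec i j p * pairVec i j q
      = n * ((2 : ℝ) • (1 : Matrix (Pairs n) (Pairs n) ℝ)) p q := by
    simp [← hI, Finset.mul_sum]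
  have e2 : ∑ _i : Fin n, ∑ j : Fin n, ∑ k, pairVec j k p * pairVec j k q
      = n * ((2 : ℝ) • (1 : Matrix (Pairs n) (Pairs n) ℝ)) p q := by
    simp [← hI]
  have e3 : ∑ i : Fin n, ∑ _j : Fin n, ∑ k, pairVec i k p * pairVec i k q
      = n * ((2 : ℝ) • (1 : Matrix (Pairs n) (Pairs n) ℝ)) p q := by
    simp [← hI, Finset.mul_sum]
  have c1 : ∀ p q : Pairs n, ∑ i : Fin n, ∑ j, ∑ k, pairVec i j p * pairVec j k q
      = ∑ i, (∑ j, pairVec i j p) * ∑ k, pairVec i k q := by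
    intro p q
    rw [Finset.sum_comm]
    refine Finset.sum_congr rfl fun j _ => ?_
    simp only [Finset.sum_mul_sum, pairVec_comm _ j]
  have c2 : ∀ p q : Pairs n, ∑ i : Fin n, ∑ j, ∑ k, pairVec i j p * pairVec i k q
      = ∑ i, (∑ j, pairVec i j p) * ∑ k, pairVec i k q := by
    intro p q
    simp only [Finset.sum_mul_sum]
  have c3 : ∀ p q : Pairs n, ∑ i : Fin n, ∑ j, ∑ k, pairVec j k p * pairVec i k q
      = ∑ i, (∑ j, pairVec i j p) * ∑ k, pairVec i k q := by
    intro p q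
    have : ∀ i : Fin n, ∑ j, ∑ k, pairVec j k p * pairVec i k q
        = ∑ k, ∑ j, pairVec j k p * pairVec i k q := fun i => Finset.sum_comm
    simp only [this]
    rw [Finset.sum_comm]
    refine Finset.sum_congr rfl fun k _ => ?_
    rw [Finset.sum_comm]
    simp only [Finset.sum_mul_sum, pairVec_comm _ k]
  have expand : ∀ i j k : Fin n, triVec i j k p * triVec i j k q =
      pairVec i j p * pairVec i j q + pairVec j k p * pairVec j k q + pairVec i k p * pairVec i k q
      + pairVec i j p * pairVec j k q + pairVec i j q * pairVec j k p
      - pairVec i j p * pairVec i k q - pairVec i j q * pairVec i k p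
      - pairVec j k p * pairVec i k q - pairVec j k q * pairVec i k p := by
    intro i j k; simp only [triVec, Pi.add_apply, Pi.sub_apply]; ring
  have hGs : ∑ i, (∑ j, pairVec i j q) * ∑ k, pairVec i k p
      = ∑ i : Fin n, (∑ j, pairVec i j p) * ∑ k, pairVec i k q :=
    Finset.sum_congr rfl fun i _ => mul_comm _ _
  simp only [Matrix.sub_apply, Matrix.sum_apply, vecMulVec_apply, triVec_outer]
  simp only [expand, Finset.sum_add_distrib, Finset.sum_sub_distrib, e1, e2, e3, c1, c2, c3, hGs]
  have e4 : ∑ i : Fin n, ∑ j, ((2 : ℝ) • pairVec i j) p * ((2 : ℝ) • pairVec i j) q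
      = 4 * ((2 : ℝ) • (1 : Matrix (Pairs n) (Pairs n) ℝ)) p q := by
    rw [← hI, Finset.mul_sum]
    refine Finset.sum_congr rfl fun i _ => ?_
    rw [Finset.mul_sum]
    refine Finset.sum_congr rfl fun j _ => ?_
    simp; ring
  rw [e4]
  simp only [Matrix.smul_apply, Matrix.sub_apply, hG, smul_eq_mul]
  ring

end Counting

/-! ### The Bose–Mesner algebra of the Johnson scheme -/

section Johnson

variable {n : ℕ}

lemma pairVec_dotProduct {i j : Fin n} (h : i ≠ j) (v : Pairs n → ℝ) :
    pairVec i j ⬝ᵥ v = v (mkPair h) := by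
  rw [pairVec_eq_single h, single_one_dotProduct]

lemma incidence_mkPair {i j : Fin n} (h : i ≠ j) (k : Fin n) :
    incidence n k (mkPair h) = (if k = i then 1 else 0) + if k = j then 1 else 0 := by
  by_cases h1 : k = i
  · have : k ≠ j := fun h2 => h (h1.symm.trans h2)
    simp [incidence, mkPair, h1, h]
  · simp [incidence, mkPair, h1]

/-- A sum over pairs containing `i` is a sum over the other endpoint. -/
lemma incidence_dotProduct (i : Fin n) (v : Pairs n → ℝ) :
    incidence n i ⬝ᵥ v = ∑ j, pairVec i j ⬝ᵥ v := by
  simp only [dotProduct, ← sum_pairVec, Finset.sum_mul]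
  exact Finset.sum_comm

lemma sum_incidence_row (i : Fin n) : ∑ p, incidence n i p = n - 1 := by
  have := incidence_dotProduct i (fun _ => 1)
  simp only [dotProduct, mul_one] at this
  rw [this, ← Finset.sum_erase_add _ _ (Finset.mem_univ i), pairVec_self]
  have h : ∀ j ∈ Finset.univ.erase i, ∑ p, pairVec i j p = 1 := fun j hj => by
    have := pairVec_dotProduct (Finset.ne_of_mem_erase hj).symm (fun _ => 1)
    simpa [dotProduct] using this
  rw [Finset.sum_congr rfl h]
  have : 1 ≤ n := by have := i.2; omega
  simp [Nat.cast_sub this]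

lemma incidence_mul_transpose :
    incidence n * (incidence n)ᵀ = ((n : ℝ) - 2) • 1 + Matrix.of fun _ _ => 1 := by
  ext i k
  have h0 : (incidence n * (incidence n)ᵀ) i k = incidence n i ⬝ᵥ incidence n k := by
    simp [Matrix.mul_apply, dotProduct]
  rw [h0, incidence_dotProduct, ← Finset.sum_erase_add _ _ (Finset.mem_univ i), pairVec_self]
  have h : ∀ j ∈ Finset.univ.erase i, pairVec i j ⬝ᵥ incidence n k
      = (if k = i then 1 else 0) + if k = j then 1 else 0 := fun j hj => by
    rw [pairVec_dotProduct (Finset.ne_of_mem_erase hj).symm, incidence_mkPair]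
  rw [Finset.sum_congr rfl h, Finset.sum_add_distrib]
  have h1 : 1 ≤ n := by have := i.2; omega
  by_cases hk : k = i
  · simp [hk, Nat.cast_sub h1]
    ring
  · simp [hk, Ne.symm hk]

lemma interMatrix_mul_self :
    interMatrix n * interMatrix n = ((n : ℝ) - 2) • interMatrix n + (4 : ℝ) • onesMatrix n := by
  have : interMatrix n * interMatrix n
      = (incidence n)ᵀ * (incidence n * (incidence n)ᵀ) * incidence n := by
    simp only [interMatrix, Matrix.mul_assoc]
  rw [this, incidence_mul_transpose, Matrix.mul_add, Matrix.add_mul]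
  congr 1
  · simp [interMatrix]
  · ext p q
    simp only [onesMatrix, Matrix.mul_apply, Matrix.transpose_apply, Matrix.of_apply, mul_one,
      sum_incidence, ← Finset.mul_sum, Matrix.smul_apply, smul_eq_mul]
    norm_num

lemma interMatrix_transpose : (interMatrix n)ᵀ = interMatrix n := by
  simp [interMatrix]

lemma onesMatrix_transpose : (onesMatrix n)ᵀ = onesMatrix n := rfl

lemma interMatrix_mul_onesMatrix :
    interMatrix n * onesMatrix n = (2 * ((n : ℝ) - 1)) • onesMatrix n := by
  rw [interMatrix, Matrix.mul_assoc]
  ext p q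
  simp only [onesMatrix, Matrix.mul_apply, Matrix.of_apply, mul_one, sum_incidence_row,
    ← Finset.sum_mul, Matrix.transpose_apply, sum_incidence, Matrix.smul_apply, smul_eq_mul]

lemma onesMatrix_mul_interMatrix :
    onesMatrix n * interMatrix n = (2 * ((n : ℝ) - 1)) • onesMatrix n := by
  rw [← onesMatrix_transpose, ← interMatrix_transpose, ← Matrix.transpose_mul,
    interMatrix_mul_onesMatrix, Matrix.transpose_smul]

lemma card_pairs : (Fintype.card (Pairs n) : ℝ) = n * (n - 1) / 2 := by
  simp [Nat.cast_choose_two]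

lemma onesMatrix_mul_self :
    onesMatrix n * onesMatrix n = ((n : ℝ) * (n - 1) / 2) • onesMatrix n := by
  rw [← card_pairs]
  ext p q
  simp [onesMatrix, Matrix.mul_apply]

/-- The coefficient of the all-ones matrix in `johnson n l₀ l₁ l₂`. -/
noncomputable def onesCoeff (n : ℕ) (l₀ l₁ l₂ : ℝ) : ℝ :=
  2 / n * ((l₀ - l₂) / (n - 1) - 2 * ((l₁ - l₂) / (n - 2)))

/-- The element of the Bose–Mesner algebra of the Johnson scheme `J(n, 2)` with eigenvalue `l₀` on
the constant vectors, `l₁` on the vectors `x_i + x_j` with `∑ x_i = 0`, and `l₂` on the orthogonal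
complement of both. -/
noncomputable def johnson (n : ℕ) (l₀ l₁ l₂ : ℝ) : Matrix (Pairs n) (Pairs n) ℝ :=
  l₂ • (1 : Matrix (Pairs n) (Pairs n) ℝ) + ((l₁ - l₂) / (n - 2)) • interMatrix n
    + onesCoeff n l₀ l₁ l₂ • onesMatrix n

lemma interMatrix_apply (p q : Pairs n) : interMatrix n p q = (p.1 ∩ q.1).card := by
  have h : ∀ i, (if i ∈ p.1 then (1 : ℝ) else 0) * (if i ∈ q.1 then 1 else 0)
      = if i ∈ p.1 ∩ q.1 then 1 else 0 := fun i => by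
    by_cases h1 : i ∈ p.1 <;> by_cases h2 : i ∈ q.1 <;> simp [h1, h2]
  simp only [interMatrix, Matrix.mul_apply, Matrix.transpose_apply, incidence, Matrix.of_apply, h]
  rw [Finset.sum_boole]
  congr 2
  ext i
  simp

lemma johnson_eq_pairMatrix (l₀ l₁ l₂ : ℝ) :
    johnson n l₀ l₁ l₂ = pairMatrix n (l₂ + 2 * ((l₁ - l₂) / (n - 2)) + onesCoeff n l₀ l₁ l₂)
      ((l₁ - l₂) / (n - 2) + onesCoeff n l₀ l₁ l₂) (onesCoeff n l₀ l₁ l₂) := by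
  ext p q
  simp only [johnson, pairMatrix, Matrix.add_apply, Matrix.smul_apply, Matrix.of_apply,
    interMatrix_apply, onesMatrix, smul_eq_mul, Matrix.one_apply]
  by_cases h : p = q
  · subst h
    simp [p.2]
    ring
  · by_cases h1 : (p.1 ∩ q.1).card = 1
    · simp [h, h1]
    · have h2 : (p.1 ∩ q.1).card ≤ 2 :=
        (Finset.card_le_card Finset.inter_subset_left).trans p.2.le
      have h3 : (p.1 ∩ q.1).card ≠ 2 := fun h3 => h <| by
        have e1 := Finset.eq_of_subset_of_card_le (Finset.inter_subset_left (s₁ := p.1) (s₂ := q.1))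
          (by rw [h3, p.2])
        have e2 := Finset.eq_of_subset_of_card_le (Finset.inter_subset_right (s₁ := p.1) (s₂ := q.1))
          (by rw [h3, q.2])
        exact Subtype.ext (e1.symm.trans e2)
      have h4 : (p.1 ∩ q.1).card = 0 := by omega
      simp [h, h4]

lemma johnson_transpose (l₀ l₁ l₂ : ℝ) : (johnson n l₀ l₁ l₂)ᵀ = johnson n l₀ l₁ l₂ := by
  simp [johnson, interMatrix_transpose, onesMatrix_transpose]

lemma johnson_one : johnson n 1 1 1 = 1 := by
  simp [johnson, onesCoeff]

lemma johnson_mul (hn : 3 ≤ n) (l₀ l₁ l₂ m₀ m₁ m₂ : ℝ) :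
    johnson n l₀ l₁ l₂ * johnson n m₀ m₁ m₂ = johnson n (l₀ * m₀) (l₁ * m₁) (l₂ * m₂) := by
  have hn' : (3 : ℝ) ≤ n := by exact_mod_cast hn
  have h0 : (n : ℝ) ≠ 0 := by linarith
  have h1 : (n : ℝ) - 1 ≠ 0 := by linarith
  have h2 : (n : ℝ) - 2 ≠ 0 := by linarith
  simp only [johnson, Matrix.add_mul, Matrix.mul_add, Matrix.smul_mul, Matrix.mul_smul,
    Matrix.one_mul, Matrix.mul_one, interMatrix_mul_self, interMatrix_mul_onesMatrix,
    onesMatrix_mul_interMatrix, onesMatrix_mul_self]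
  ext p q
  simp only [Matrix.add_apply, Matrix.smul_apply, smul_eq_mul]
  generalize interMatrix n p q = g
  generalize onesMatrix n p q = o
  generalize (1 : Matrix (Pairs n) (Pairs n) ℝ) p q = e
  simp only [onesCoeff]
  field_simp
  ring

/-- The sum of the outer products of the triangle normals has eigenvalues proportional to
`n - 2`, `2n - 2` and `3n - 4`. -/
lemma sum_vecMulVec_triVec_eq_johnson (hn : 3 ≤ n) :
    ∑ x ∈ triples n, vecMulVec (triVec x.1 x.2.1 x.2.2) (triVec x.1 x.2.1 x.2.2) =
      (2 : ℝ) • johnson n (n - 2) (2 * n - 2) (3 * n - 4) := by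
  have hn' : (3 : ℝ) ≤ n := by exact_mod_cast hn
  have h0 : (n : ℝ) ≠ 0 := by linarith
  have h1 : (n : ℝ) - 1 ≠ 0 := by linarith
  have h2 : (n : ℝ) - 2 ≠ 0 := by linarith
  have e1 : (2 * n - 2 - (3 * n - 4)) / ((n : ℝ) - 2) = -1 := by field_simp; ring
  have e2 : onesCoeff n (n - 2) (2 * n - 2) (3 * n - 4) = 0 := by
    simp only [onesCoeff]; field_simp; ring
  rw [sum_vecMulVec_triVec, johnson, e1, e2]
  module

lemma johnson_smul_add (a b l₀ l₁ l₂ m₀ m₁ m₂ : ℝ) :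
    a • johnson n l₀ l₁ l₂ + b • johnson n m₀ m₁ m₂ =
      johnson n (a * l₀ + b * m₀) (a * l₁ + b * m₁) (a * l₂ + b * m₂) := by
  ext p q
  simp only [johnson, onesCoeff, Matrix.add_apply, Matrix.smul_apply, smul_eq_mul]
  ring

lemma dotProduct_johnson_mulVec (l₀ l₁ l₂ : ℝ) (v : Pairs n → ℝ) :
    v ⬝ᵥ johnson n l₀ l₁ l₂ *ᵥ v = l₂ * (v ⬝ᵥ v)
      + (l₁ - l₂) / (n - 2) * (incidence n *ᵥ v ⬝ᵥ incidence n *ᵥ v)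
      + onesCoeff n l₀ l₁ l₂ * (∑ p, v p) ^ 2 := by
  have h1 : v ⬝ᵥ interMatrix n *ᵥ v = incidence n *ᵥ v ⬝ᵥ incidence n *ᵥ v := by
    rw [interMatrix, ← Matrix.mulVec_mulVec, Matrix.dotProduct_mulVec, Matrix.vecMul_transpose]
  have h2 : v ⬝ᵥ onesMatrix n *ᵥ v = (∑ p, v p) ^ 2 := by
    simp [onesMatrix, dotProduct, Matrix.mulVec, ← Finset.sum_mul, sq]
  simp only [johnson, Matrix.add_mulVec, Matrix.smul_mulVec, dotProduct_add, dotProduct_smul,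
    Matrix.one_mulVec, h1, h2, smul_eq_mul]

lemma incidence_mulVec_pairVec {i j : Fin n} (h : i ≠ j) :
    incidence n *ᵥ pairVec i j = Pi.single i 1 + Pi.single j 1 := by
  funext k
  rw [Matrix.mulVec, dotProduct_comm, pairVec_dotProduct h, incidence_mkPair]
  simp [Pi.single_apply]

lemma sum_pairVec_apply {i j : Fin n} (h : i ≠ j) : ∑ p, pairVec i j p = 1 := by
  have := pairVec_dotProduct h (fun _ => 1)
  simpa [dotProduct] using this

lemma pairVec_dotProduct_self {i j : Fin n} (h : i ≠ j) : pairVec i j ⬝ᵥ pairVec i j = 1 := by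
  rw [pairVec_dotProduct h]; simp [pairVec, mkPair]

lemma pairVec_dotProduct_of_ne {i j k : Fin n} (h : i ≠ j) (hk : j ≠ k) :
    pairVec i j ⬝ᵥ pairVec i k = 0 := by
  have : ({i, j} : Finset (Fin n)) ≠ {i, k} := fun e => by
    have : j ∈ ({i, k} : Finset (Fin n)) := e ▸ by simp
    simp [h.symm, hk] at this
  rw [pairVec_dotProduct h]; simp [pairVec, mkPair, this]

lemma pairVec_dotProduct_johnson {i j : Fin n} (h : i ≠ j) (l₀ l₁ l₂ : ℝ) :
    pairVec i j ⬝ᵥ johnson n l₀ l₁ l₂ *ᵥ pairVec i j =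
      l₂ + 2 * ((l₁ - l₂) / (n - 2)) + onesCoeff n l₀ l₁ l₂ := by
  rw [dotProduct_johnson_mulVec, incidence_mulVec_pairVec h, pairVec_dotProduct_self h,
    sum_pairVec_apply h]
  simp [h, h.symm]
  ring

lemma triVec_dotProduct_johnson {i j k : Fin n} (hij : i ≠ j) (hjk : j ≠ k) (hik : i ≠ k)
    (l₀ l₁ l₂ : ℝ) :
    triVec i j k ⬝ᵥ johnson n l₀ l₁ l₂ *ᵥ triVec i j k =
      3 * l₂ + 4 * ((l₁ - l₂) / (n - 2)) + onesCoeff n l₀ l₁ l₂ := by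
  have h1 : incidence n *ᵥ triVec i j k = (2 : ℝ) • Pi.single j 1 := by
    simp only [triVec, Matrix.mulVec_add, Matrix.mulVec_sub, incidence_mulVec_pairVec hij,
      incidence_mulVec_pairVec hjk, incidence_mulVec_pairVec hik]
    module
  have h2 : ∑ p, triVec i j k p = 1 := by
    simp only [triVec, Pi.add_apply, Pi.sub_apply, Finset.sum_add_distrib, Finset.sum_sub_distrib,
      sum_pairVec_apply hij, sum_pairVec_apply hjk, sum_pairVec_apply hik]
    norm_num
  have h3 : triVec i j k ⬝ᵥ triVec i j k = 3 := by
    have e1 : pairVec i j ⬝ᵥ pairVec j k = 0 := by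
      rw [pairVec_comm i j]; exact pairVec_dotProduct_of_ne hij.symm hik
    have e2 := pairVec_dotProduct_of_ne hij hjk
    have e3 : pairVec j k ⬝ᵥ pairVec i k = 0 := by
      rw [pairVec_comm i k, pairVec_comm j k]; exact pairVec_dotProduct_of_ne hjk.symm hij.symm
    simp only [triVec, add_dotProduct, sub_dotProduct, dotProduct_add, dotProduct_sub,
      pairVec_dotProduct_self hij, pairVec_dotProduct_self hjk, pairVec_dotProduct_self hik,
      e1, e2, e3, dotProduct_comm (pairVec j k) (pairVec i j),
      dotProduct_comm (pairVec i k) (pairVec i j), dotProduct_comm (pairVec i k) (pairVec j k)]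
    norm_num
  rw [dotProduct_johnson_mulVec, h1, h2, h3]
  simp
  ring

end Johnson

/-! ### Ellipsoids: support functions, volume, and the determinant inequality -/

section EllipsoidGeometry

variable {ι : Type*} [Fintype ι]

lemma norm_toLp_sq (v : ι → ℝ) : ‖WithLp.toLp 2 v‖ ^ 2 = v ⬝ᵥ v := by
  rw [EuclideanSpace.real_norm_sq_eq]
  simp [dotProduct, sq]

lemma dotProduct_le_norm_mul_norm (v w : ι → ℝ) :
    v ⬝ᵥ w ≤ ‖WithLp.toLp 2 v‖ * ‖WithLp.toLp 2 w‖ := by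
  have := real_inner_le_norm (WithLp.toLp 2 w) (WithLp.toLp 2 v)
  rw [EuclideanSpace.inner_eq_star_dotProduct] at this
  simpa [mul_comm] using this

variable [DecidableEq ι]

lemma dotProduct_le_of_mem_affineBall {A : Matrix ι ι ℝ} (hA : Aᵀ = A) {c x : EuclideanSpace ℝ ι}
    (hx : x ∈ affineBall A c) (a : ι → ℝ) :
    a ⬝ᵥ x.ofLp ≤ ‖WithLp.toLp 2 (A *ᵥ a)‖ + a ⬝ᵥ c.ofLp := by
  obtain ⟨u, hu, rfl⟩ := hx
  have hu' : ‖u‖ ≤ 1 := by simpa using hu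
  have h1 : a ⬝ᵥ (A *ᵥ u.ofLp) = (A *ᵥ a) ⬝ᵥ u.ofLp := by
    rw [Matrix.dotProduct_mulVec, ← Matrix.mulVec_transpose, hA]
  have h2 := dotProduct_le_norm_mul_norm (A *ᵥ a) u.ofLp
  have h3 : ‖WithLp.toLp 2 (A *ᵥ a)‖ * ‖u‖ ≤ ‖WithLp.toLp 2 (A *ᵥ a)‖ :=
    mul_le_of_le_one_right (norm_nonneg _) hu'
  have h4 : (A.toEuclideanLin u + c).ofLp = A *ᵥ u.ofLp + c.ofLp := rfl
  simp only [h4, dotProduct_add, h1]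
  have : WithLp.toLp 2 u.ofLp = u := rfl
  rw [this] at h2
  linarith

/-- The support function of `A B + c` at `a` is `‖A a‖ + ⟪a, c⟫`, so a half-space containing the
ellipsoid satisfies the corresponding inequality. -/
lemma norm_mulVec_add_le_of_affineBall {A : Matrix ι ι ℝ} (hA : Aᵀ = A) {c : EuclideanSpace ℝ ι}
    {a : ι → ℝ} {b : ℝ} (h : ∀ x ∈ affineBall A c, a ⬝ᵥ x.ofLp ≤ b) :
    ‖WithLp.toLp 2 (A *ᵥ a)‖ + a ⬝ᵥ c.ofLp ≤ b := by
  set v := WithLp.toLp 2 (A *ᵥ a) with hv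
  -- The supremum over the ball is attained at `v / ‖v‖`.
  by_cases h0 : ‖v‖ = 0
  · have := h (A.toEuclideanLin 0 + c) ⟨0, by simp, rfl⟩
    simpa [h0] using this
  · have := h (A.toEuclideanLin (‖v‖⁻¹ • v) + c)
      ⟨‖v‖⁻¹ • v, by simp [norm_smul, inv_mul_cancel₀ h0], rfl⟩
    have h4 : (A.toEuclideanLin (‖v‖⁻¹ • v) + c).ofLp = ‖v‖⁻¹ • (A *ᵥ v.ofLp) + c.ofLp := by
      rw [map_smul]; rfl
    have h1 : a ⬝ᵥ (A *ᵥ v.ofLp) = ‖v‖ ^ 2 := by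
      rw [Matrix.dotProduct_mulVec, ← Matrix.mulVec_transpose, hA, hv, norm_toLp_sq]
    rw [h4, dotProduct_add, dotProduct_smul, h1, smul_eq_mul] at this
    have h5 : ‖v‖⁻¹ * ‖v‖ ^ 2 = ‖v‖ := by field_simp
    rwa [h5] at this

lemma volume_affineBall (A : Matrix ι ι ℝ) (c : EuclideanSpace ℝ ι) :
    MeasureTheory.volume (affineBall A c) = ENNReal.ofReal |A.det| *
      MeasureTheory.volume (Metric.closedBall (0 : EuclideanSpace ℝ ι) 1) := by
  have h : affineBall A c =
      (fun x => x + c) '' (A.toEuclideanLin '' Metric.closedBall (0 : EuclideanSpace ℝ ι) 1) := by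
    rw [Set.image_image]; rfl
  have hdet : LinearMap.det A.toEuclideanLin = A.det := LinearMap.det_toLpLin 2 A
  rw [h, Set.image_add_right, MeasureTheory.measure_preimage_add_right,
    MeasureTheory.Measure.addHaar_image_linearMap, hdet]

lemma volume_affineBall_lt {A B : Matrix ι ι ℝ} (h : |A.det| < |B.det|)
    (c d : EuclideanSpace ℝ ι) :
    MeasureTheory.volume (affineBall A c) < MeasureTheory.volume (affineBall B d) := by
  rw [volume_affineBall, volume_affineBall]
  refine ENNReal.mul_lt_mul_left (Metric.measure_closedBall_pos _ _ one_pos).ne'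
    MeasureTheory.measure_closedBall_lt_top.ne ?_
  exact (ENNReal.ofReal_lt_ofReal_iff ((abs_nonneg _).trans_lt h)).2 h

/-- The equality case of the inequality of arithmetic and geometric means for the eigenvalues. -/
lemma eq_one_of_trace_le_of_one_le_det {X : Matrix ι ι ℝ} (hX : X.PosSemidef)
    (htr : X.trace ≤ Fintype.card ι) (hdet : 1 ≤ X.det) : X = 1 := by
  have hH := hX.isHermitian
  have hd : X.det = ∏ i, hH.eigenvalues i := by simpa using hH.det_eq_prod_eigenvalues
  have ht : X.trace = ∑ i, hH.eigenvalues i := by simpa using hH.trace_eq_sum_eigenvalues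
  have hne : ∀ i, hH.eigenvalues i ≠ 0 := fun i h0 => by
    rw [Finset.prod_eq_zero (Finset.mem_univ i) h0] at hd
    linarith
  have hpos : ∀ i, 0 < hH.eigenvalues i := fun i =>
    lt_of_le_of_ne (hX.eigenvalues_nonneg i) (hne i).symm
  have hlog : 0 ≤ ∑ i, Real.log (hH.eigenvalues i) := by
    rw [← Real.log_prod (fun i _ => hne i), ← hd]
    exact Real.log_nonneg hdet
  have hle : ∀ i ∈ Finset.univ, 0 ≤ hH.eigenvalues i - 1 - Real.log (hH.eigenvalues i) :=
    fun i _ => by linarith [Real.log_le_sub_one_of_pos (hpos i)]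
  have hsum : ∑ i, (hH.eigenvalues i - 1 - Real.log (hH.eigenvalues i)) = 0 := by
    refine le_antisymm ?_ (Finset.sum_nonneg hle)
    simp only [Finset.sum_sub_distrib, Finset.sum_const, Finset.card_univ, nsmul_eq_mul, mul_one]
    linarith
  have hone : ∀ i, hH.eigenvalues i = 1 := fun i => by
    by_contra hi
    have h1 := (Finset.sum_eq_zero_iff_of_nonneg hle).1 hsum i (Finset.mem_univ i)
    linarith [Real.log_lt_sub_one_of_pos (hpos i) hi]
  have hs := hH.spectral_theorem
  have : (RCLike.ofReal ∘ hH.eigenvalues : ι → ℝ) = fun _ => 1 := by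
    funext i; simp [hone i]
  rw [this] at hs
  rw [hs]
  simp

/-- Among positive semidefinite `B` with `tr (A⁻¹ B) ≤ dim`, where `A⁻¹ = D * D`, the matrix `A` is
the only one whose determinant is at least `det A`. -/
lemma eq_of_trace_le_of_det_le {B C D : Matrix ι ι ℝ} (hB : B.PosSemidef) (hD : Dᵀ = D)
    (hDC : D * C = 1) (htr : (D * D * B).trace ≤ Fintype.card ι) (hdet : (C * C).det ≤ B.det) :
    B = C * C := by
  have hCD : C * D = 1 := mul_eq_one_comm.1 hDC
  have hX : (D * B * D).PosSemidef := by
    have := hB.conjTranspose_mul_mul_same D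
    rwa [Matrix.conjTranspose_eq_transpose_of_trivial, hD] at this
  have htr' : (D * B * D).trace ≤ Fintype.card ι := by
    rwa [Matrix.trace_mul_comm, ← Matrix.mul_assoc]
  have hdet1 : D.det * C.det = 1 := by rw [← Matrix.det_mul, hDC, Matrix.det_one]
  have hdet' : 1 ≤ (D * B * D).det := by
    rw [Matrix.det_mul] at hdet
    rw [Matrix.det_mul, Matrix.det_mul]
    nlinarith [mul_le_mul_of_nonneg_left hdet (sq_nonneg D.det)]
  have h1 := eq_one_of_trace_le_of_one_le_det hX htr' hdet'
  calc B = (C * D) * B * (D * C) := by rw [hCD, hDC, Matrix.one_mul, Matrix.mul_one]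
    _ = C * (D * B * D) * C := by simp only [Matrix.mul_assoc]
    _ = C * C := by rw [h1, Matrix.mul_one]

end EllipsoidGeometry

/-! ### Inequality description of the metric polytope -/

section Polytope

variable {n : ℕ}

lemma triVec_dotProduct {i j k : Fin n} (hij : i ≠ j) (hjk : j ≠ k) (hik : i ≠ k)
    (v : Pairs n → ℝ) :
    triVec i j k ⬝ᵥ v = v (mkPair hij) + v (mkPair hjk) - v (mkPair hik) := by
  simp only [triVec, add_dotProduct, sub_dotProduct, pairVec_dotProduct hij,
    pairVec_dotProduct hjk, pairVec_dotProduct hik]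

lemma mkPair_comm {i j : Fin n} (h : i ≠ j) : mkPair h.symm = mkPair h :=
  Subtype.ext (Finset.pair_comm j i)

lemma exists_ne_ne (hn : 3 ≤ n) (i j : Fin n) : ∃ k, j ≠ k ∧ i ≠ k := by
  obtain ⟨k, hk⟩ : ∃ k, k ∉ ({i, j} : Finset (Fin n)) := by
    by_contra! h
    have h1 := Finset.card_le_card (fun k _ => h k : (Finset.univ : Finset (Fin n)) ⊆ {i, j})
    have h2 := Finset.card_le_two (a := i) (b := j)
    simp at h1
    omega
  simp only [Finset.mem_insert, Finset.mem_singleton, not_or] at hk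
  exact ⟨k, Ne.symm hk.2, Ne.symm hk.1⟩

/-- For `n ≥ 3` the nonnegativity constraints follow from the triangle inequalities. -/
lemma mem_metricPolytope_iff (hn : 3 ≤ n) (d : PairSpace n) :
    d ∈ metricPolytope n ↔ (∀ p, d p ≤ 1) ∧
      ∀ i j k : Fin n, i ≠ j → j ≠ k → i ≠ k → 0 ≤ triVec i j k ⬝ᵥ d.ofLp := by
  constructor
  · rintro ⟨h1, h2⟩
    refine ⟨fun p => (h2 p).2, fun i j k hij hjk hik => ?_⟩
    rw [triVec_dotProduct hij hjk hik]
    exact (h1 i j k hij hjk hik).2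
  · rintro ⟨h1, h2⟩
    have h0 : ∀ p, 0 ≤ d p := fun p => by
      obtain ⟨i, j, hij, rfl⟩ := exists_eq_mkPair p
      obtain ⟨k, hjk, hik⟩ := exists_ne_ne hn i j
      have e1 := h2 i j k hij hjk hik
      have e2 := h2 j i k hij.symm hik hjk
      rw [triVec_dotProduct hij hjk hik] at e1
      rw [triVec_dotProduct hij.symm hik hjk, mkPair_comm hij] at e2
      linarith
    refine ⟨fun i j k hij hjk hik => ⟨h0 _, ?_⟩, fun p => ⟨h0 p, h1 p⟩⟩
    have := h2 i j k hij hjk hik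
    rwa [triVec_dotProduct hij hjk hik] at this

lemma triVec_dotProduct_mem_Icc (hn : 3 ≤ n) {d : PairSpace n} (hd : d ∈ metricPolytope n)
    {x : Fin n × Fin n × Fin n} (hx : x ∈ triples n) :
    triVec x.1 x.2.1 x.2.2 ⬝ᵥ d.ofLp ∈ Set.Icc (0 : ℝ) 2 := by
  obtain ⟨i, j, k⟩ := x
  have hik : i ≠ k := by simpa [triples] using hx
  by_cases hij : i = j
  · subst hij; simp [triVec_left]
  by_cases hjk : j = k
  · subst hjk; simp [triVec_right]
  refine ⟨((mem_metricPolytope_iff hn d).1 hd).2 i j k hij hjk hik, ?_⟩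
  have h := hd.2
  simp only [triVec_dotProduct hij hjk hik]
  linarith [(h (mkPair hij)).2, (h (mkPair hjk)).2, (h (mkPair hik)).1]

end Polytope

/-! ### The largest ellipsoid -/

section Optimum

variable {n : ℕ}

/-- The weight `m / N` of the constant vectors, an eigenspace of the Johnson scheme of dimension
`m = 1` in dimension `N = n (n - 1) / 2`. -/
noncomputable def weight₀ (n : ℕ) : ℝ := 2 / (n * (n - 1))

/-- The weight `m / N` of the second eigenspace, of dimension `m = n - 1`. -/
noncomputable def weight₁ (n : ℕ) : ℝ := 2 / n

/-- The weight `m / N` of the third eigenspace, of dimension `m = n (n - 3) / 2`. -/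
noncomputable def weight₂ (n : ℕ) : ℝ := (n - 3) / (n - 1)

/-- The eigenvalue on the second eigenspace of the sum of outer products of triangle normals,
scaled so that the eigenvalue on the constant vectors is `1`. -/
noncomputable def tri₁ (n : ℕ) : ℝ := 2 * (n - 1) / (n - 2)

/-- The analogue of `tri₁` for the third eigenspace. -/
noncomputable def tri₂ (n : ℕ) : ℝ := (3 * n - 4) / (n - 2)

/-- The squared eigenvalue of the optimal matrix on an eigenspace where the triangle sum has the
scaled eigenvalue `τ`. -/
noncomputable def eigSq (κ τ : ℝ) : ℝ := κ / ((1 + κ) * (1 + κ * τ))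

/-- The function whose positive zero is the ratio `κ = (1 - δ) / δ` of the optimal ellipsoid. -/
noncomputable def ratioFun (n : ℕ) (κ : ℝ) : ℝ :=
  weight₀ n / (1 + κ) + weight₁ n / (1 + κ * tri₁ n) + weight₂ n / (1 + κ * tri₂ n) - κ / (1 + κ)

/-- The matrix of the largest ellipsoid when `ratioFun n κ = 0`. -/
noncomputable def optMatrix (n : ℕ) (κ : ℝ) : Matrix (Pairs n) (Pairs n) ℝ :=
  johnson n √(eigSq κ 1) √(eigSq κ (tri₁ n)) √(eigSq κ (tri₂ n))

/-- The inverse of `optMatrix n κ`, for `3 ≤ n` and `0 < κ`. -/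
noncomputable def optInv (n : ℕ) (κ : ℝ) : Matrix (Pairs n) (Pairs n) ℝ :=
  johnson n (√(eigSq κ 1))⁻¹ (√(eigSq κ (tri₁ n)))⁻¹ (√(eigSq κ (tri₂ n)))⁻¹

/-- The inverse of the square of `optMatrix n κ`, for `3 ≤ n` and `0 < κ`. -/
noncomputable def optInvSq (n : ℕ) (κ : ℝ) : Matrix (Pairs n) (Pairs n) ℝ :=
  johnson n (eigSq κ 1)⁻¹ (eigSq κ (tri₁ n))⁻¹ (eigSq κ (tri₂ n))⁻¹

lemma tri₁_pos (hn : 3 ≤ n) : 0 < tri₁ n := by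
  have hn' : (3 : ℝ) ≤ n := by exact_mod_cast hn
  exact div_pos (by linarith) (by linarith)

lemma tri₂_pos (hn : 3 ≤ n) : 0 < tri₂ n := by
  have hn' : (3 : ℝ) ≤ n := by exact_mod_cast hn
  exact div_pos (by linarith) (by linarith)

lemma eigSq_pos {κ τ : ℝ} (hκ : 0 < κ) (hτ : 0 < τ) : 0 < eigSq κ τ := by
  unfold eigSq; positivity

lemma weight_sum (hn : 3 ≤ n) : weight₀ n + weight₁ n + weight₂ n = 1 := by
  have hn' : (3 : ℝ) ≤ n := by exact_mod_cast hn
  have h0 : (n : ℝ) ≠ 0 := by linarith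
  have h1 : (n : ℝ) - 1 ≠ 0 := by linarith
  unfold weight₀ weight₁ weight₂
  field_simp
  ring

/-- A coordinate vector has squared norm `m / N` in projection to each eigenspace. -/
lemma pairVec_quadForm (hn : 3 ≤ n) {i j : Fin n} (h : i ≠ j) (l₀ l₁ l₂ : ℝ) :
    pairVec i j ⬝ᵥ johnson n l₀ l₁ l₂ *ᵥ pairVec i j =
      weight₀ n * l₀ + weight₁ n * l₁ + weight₂ n * l₂ := by
  have hn' : (3 : ℝ) ≤ n := by exact_mod_cast hn
  have h0 : (n : ℝ) ≠ 0 := by linarith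
  have h1 : (n : ℝ) - 1 ≠ 0 := by linarith
  have h2 : (n : ℝ) - 2 ≠ 0 := by linarith
  rw [pairVec_dotProduct_johnson h]
  unfold weight₀ weight₁ weight₂ onesCoeff
  field_simp
  ring

lemma triVec_quadForm (hn : 3 ≤ n) {i j k : Fin n} (hij : i ≠ j) (hjk : j ≠ k) (hik : i ≠ k)
    (l₀ l₁ l₂ : ℝ) :
    triVec i j k ⬝ᵥ johnson n l₀ l₁ l₂ *ᵥ triVec i j k =
      weight₀ n * l₀ + weight₁ n * (tri₁ n * l₁) + weight₂ n * (tri₂ n * l₂) := by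
  have hn' : (3 : ℝ) ≤ n := by exact_mod_cast hn
  have h0 : (n : ℝ) ≠ 0 := by linarith
  have h1 : (n : ℝ) - 1 ≠ 0 := by linarith
  have h2 : (n : ℝ) - 2 ≠ 0 := by linarith
  rw [triVec_dotProduct_johnson hij hjk hik]
  unfold weight₀ weight₁ weight₂ tri₁ tri₂ onesCoeff
  field_simp
  ring

lemma optMatrix_transpose (κ : ℝ) : (optMatrix n κ)ᵀ = optMatrix n κ := johnson_transpose _ _ _

lemma optMatrix_mul_self (hn : 3 ≤ n) {κ : ℝ} (hκ : 0 < κ) :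
    optMatrix n κ * optMatrix n κ =
      johnson n (eigSq κ 1) (eigSq κ (tri₁ n)) (eigSq κ (tri₂ n)) := by
  rw [optMatrix, johnson_mul hn, Real.mul_self_sqrt (eigSq_pos hκ one_pos).le,
    Real.mul_self_sqrt (eigSq_pos hκ (tri₁_pos hn)).le,
    Real.mul_self_sqrt (eigSq_pos hκ (tri₂_pos hn)).le]

lemma optInv_mul (hn : 3 ≤ n) {κ : ℝ} (hκ : 0 < κ) : optInv n κ * optMatrix n κ = 1 := by
  have h : ∀ τ, 0 < τ → √(eigSq κ τ) ≠ 0 := fun τ hτ => (Real.sqrt_pos.2 (eigSq_pos hκ hτ)).ne'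
  rw [optInv, optMatrix, johnson_mul hn, inv_mul_cancel₀ (h _ one_pos),
    inv_mul_cancel₀ (h _ (tri₁_pos hn)), inv_mul_cancel₀ (h _ (tri₂_pos hn)), johnson_one]

lemma optInv_mul_self (hn : 3 ≤ n) {κ : ℝ} (hκ : 0 < κ) :
    optInv n κ * optInv n κ = optInvSq n κ := by
  rw [optInv, johnson_mul hn, ← mul_inv, ← mul_inv, ← mul_inv,
    Real.mul_self_sqrt (eigSq_pos hκ one_pos).le,
    Real.mul_self_sqrt (eigSq_pos hκ (tri₁_pos hn)).le,
    Real.mul_self_sqrt (eigSq_pos hκ (tri₂_pos hn)).le, optInvSq]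

/-- The decomposition of `A⁻²` over the normals of the active constraints, which is the optimality
condition of the ellipsoid. -/
lemma optInvSq_eq (hn : 3 ≤ n) {κ : ℝ} (hκ : 0 < κ) :
    optInvSq n κ = ((1 + κ) / κ) • (1 : Matrix (Pairs n) (Pairs n) ℝ) +
      ((1 + κ) / (n - 2) / 2) • ∑ x ∈ triples n,
        vecMulVec (triVec x.1 x.2.1 x.2.2) (triVec x.1 x.2.1 x.2.2) := by
  have hn' : (3 : ℝ) ≤ n := by exact_mod_cast hn
  have h2 : (n : ℝ) - 2 ≠ 0 := by linarith
  rw [sum_vecMulVec_triVec_eq_johnson hn, smul_smul, ← johnson_one, johnson_smul_add, optInvSq]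
  unfold eigSq tri₁ tri₂
  congr 1 <;> field_simp

lemma mul_eigSq {κ : ℝ} (hκ : 0 < κ) {τ : ℝ} (hτ : 0 < τ) :
    τ * eigSq κ τ = (1 + κ)⁻¹ * (1 - 1 / (1 + κ * τ)) := by
  unfold eigSq; field_simp; ring

lemma norm_mulVec_sq {ι : Type*} [Fintype ι] {A : Matrix ι ι ℝ} (hA : Aᵀ = A) (v : ι → ℝ) :
    ‖WithLp.toLp 2 (A *ᵥ v)‖ ^ 2 = v ⬝ᵥ (A * A) *ᵥ v := by
  rw [norm_toLp_sq, ← Matrix.mulVec_mulVec, Matrix.dotProduct_mulVec v, ← Matrix.mulVec_transpose,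
    hA]

/-- The ellipsoid touches the facets `d_p = 1`. -/
lemma norm_optMatrix_pairVec (hn : 3 ≤ n) {κ : ℝ} (hκ : 0 < κ) (hr : ratioFun n κ = 0)
    {i j : Fin n} (h : i ≠ j) :
    ‖WithLp.toLp 2 (optMatrix n κ *ᵥ pairVec i j)‖ = κ / (1 + κ) := by
  have h1 := tri₁_pos hn
  have h2 := tri₂_pos hn
  rw [← sq_eq_sq₀ (norm_nonneg _) (by positivity), norm_mulVec_sq (optMatrix_transpose κ),
    optMatrix_mul_self hn hκ, pairVec_quadForm hn h]
  have e : ∀ τ, eigSq κ τ = κ / (1 + κ) * (1 / (1 + κ * τ)) := fun τ => by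
    unfold eigSq; rw [div_mul_div_comm, mul_one]
  have hr' : weight₀ n / (1 + κ) + weight₁ n / (1 + κ * tri₁ n) + weight₂ n / (1 + κ * tri₂ n)
      = κ / (1 + κ) := by unfold ratioFun at hr; linarith
  calc _ = κ / (1 + κ) * (weight₀ n / (1 + κ) + weight₁ n / (1 + κ * tri₁ n)
        + weight₂ n / (1 + κ * tri₂ n)) := by simp only [e, mul_one]; ring
    _ = _ := by rw [hr', sq]

/-- The ellipsoid touches the triangle facets: the squared norm is `1 / (1 + κ) ^ 2` because
`ratioFun n κ = 0` and the weights sum to `1`. -/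
lemma norm_optMatrix_triVec (hn : 3 ≤ n) {κ : ℝ} (hκ : 0 < κ) (hr : ratioFun n κ = 0)
    {i j k : Fin n} (hij : i ≠ j) (hjk : j ≠ k) (hik : i ≠ k) :
    ‖WithLp.toLp 2 (optMatrix n κ *ᵥ triVec i j k)‖ = 1 / (1 + κ) := by
  have h1 := tri₁_pos hn
  have h2 := tri₂_pos hn
  rw [← sq_eq_sq₀ (norm_nonneg _) (by positivity), norm_mulVec_sq (optMatrix_transpose κ),
    optMatrix_mul_self hn hκ, triVec_quadForm hn hij hjk hik]
  have hr' : weight₀ n / (1 + κ) + weight₁ n / (1 + κ * tri₁ n) + weight₂ n / (1 + κ * tri₂ n)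
      = κ / (1 + κ) := by unfold ratioFun at hr; linarith
  have e0 := mul_eigSq hκ one_pos
  rw [one_mul, mul_one] at e0
  rw [e0, mul_eigSq hκ h1, mul_eigSq hκ h2]
  calc _ = (1 + κ)⁻¹ * ((weight₀ n + weight₁ n + weight₂ n) - (weight₀ n / (1 + κ)
        + weight₁ n / (1 + κ * tri₁ n) + weight₂ n / (1 + κ * tri₂ n))) := by ring
    _ = _ := by rw [hr', weight_sum hn]; field_simp; ring

lemma optMatrix_posSemidef (hn : 3 ≤ n) (κ : ℝ) : (optMatrix n κ).PosSemidef := by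
  have h := Matrix.posSemidef_conjTranspose_mul_self
    (johnson n √√(eigSq κ 1) √√(eigSq κ (tri₁ n)) √√(eigSq κ (tri₂ n)))
  rwa [Matrix.conjTranspose_eq_transpose_of_trivial, johnson_transpose, johnson_mul hn,
    Real.mul_self_sqrt (Real.sqrt_nonneg _), Real.mul_self_sqrt (Real.sqrt_nonneg _),
    Real.mul_self_sqrt (Real.sqrt_nonneg _)] at h

lemma triVec_dotProduct_constVec {i j k : Fin n} (hij : i ≠ j) (hjk : j ≠ k) (hik : i ≠ k)
    (δ : ℝ) : triVec i j k ⬝ᵥ (constVec n δ).ofLp = δ := by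
  rw [triVec_dotProduct hij hjk hik]
  simp [constVec]

lemma affineBall_optMatrix_subset (hn : 3 ≤ n) {κ : ℝ} (hκ : 0 < κ) (hr : ratioFun n κ = 0) :
    affineBall (optMatrix n κ) (constVec n (1 / (1 + κ))) ⊆ metricPolytope n := by
  intro x hx
  rw [mem_metricPolytope_iff hn]
  have hA := optMatrix_transpose (n := n) κ
  constructor
  · intro p
    obtain ⟨i, j, hij, rfl⟩ := exists_eq_mkPair p
    have := dotProduct_le_of_mem_affineBall hA hx (pairVec i j)
    rw [norm_optMatrix_pairVec hn hκ hr hij, pairVec_dotProduct hij, pairVec_dotProduct hij] at this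
    refine this.trans (le_of_eq ?_)
    simp only [constVec]
    field_simp
    ring
  · intro i j k hij hjk hik
    have := dotProduct_le_of_mem_affineBall hA hx (-triVec i j k)
    rw [Matrix.mulVec_neg, WithLp.toLp_neg, norm_neg, norm_optMatrix_triVec hn hκ hr hij hjk hik,
      neg_dotProduct, neg_dotProduct, triVec_dotProduct_constVec hij hjk hik] at this
    linarith

lemma trace_mul_eq_sum {ι : Type*} [Fintype ι] [DecidableEq ι] {A : Matrix ι ι ℝ} (hA : Aᵀ = A)
    (B : Matrix ι ι ℝ) :
    (A * B).trace = ∑ p, (A *ᵥ Pi.single p 1) ⬝ᵥ (B *ᵥ Pi.single p 1) := by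
  simp only [Matrix.trace, Matrix.diag, Matrix.mulVec_single_one]
  refine Finset.sum_congr rfl fun p _ => ?_
  rw [Matrix.mul_apply]
  refine Finset.sum_congr rfl fun q _ => ?_
  have : A p q = A q p := congrFun (congrFun hA.symm p) q
  rw [this]; rfl

lemma trace_vecMulVec_mul {ι : Type*} [Fintype ι] {A : Matrix ι ι ℝ} (hA : Aᵀ = A)
    (B : Matrix ι ι ℝ) (v : ι → ℝ) :
    (vecMulVec v v * A * B).trace = (A *ᵥ v) ⬝ᵥ (B *ᵥ v) := by
  rw [Matrix.mul_assoc, Matrix.trace_mul_comm, Matrix.mul_vecMulVec, Matrix.trace_vecMulVec,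
    ← Matrix.mulVec_mulVec, dotProduct_comm, Matrix.dotProduct_mulVec, ← Matrix.mulVec_transpose, hA]

lemma sum_triVec_dotProduct (v : Pairs n → ℝ) :
    ∑ x ∈ triples n, triVec x.1 x.2.1 x.2.2 ⬝ᵥ v = (2 * n - 4) * ∑ p, v p := by
  rw [Finset.mul_sum]
  simp only [dotProduct]
  rw [Finset.sum_comm]
  refine Finset.sum_congr rfl fun p _ => ?_
  rw [← Finset.sum_mul, sum_triVec]

/-- An ellipsoid `B 𝐁 + c` in the metric polytope satisfies `tr (A⁻¹ B) ≤ dim`: the sum of its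
constraints, weighted by the multipliers of the optimality condition. -/
lemma trace_le_of_affineBall_subset (hn : 3 ≤ n) {κ : ℝ} (hκ : 0 < κ) (hr : ratioFun n κ = 0)
    {B : Matrix (Pairs n) (Pairs n) ℝ} {c : PairSpace n}
    (hE : ∀ i j : Fin n, ∀ h : i ≠ j,
      ‖WithLp.toLp 2 (B *ᵥ pairVec i j)‖ + c (mkPair h) ≤ 1)
    (hT : ∀ i j k : Fin n, i ≠ j → j ≠ k → i ≠ k →
      ‖WithLp.toLp 2 (B *ᵥ triVec i j k)‖ ≤ triVec i j k ⬝ᵥ c.ofLp) :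
    (optInvSq n κ * optMatrix n κ * B).trace ≤ Fintype.card (Pairs n) := by
  have hn' : (3 : ℝ) ≤ n := by exact_mod_cast hn
  have h2 : 0 < (n : ℝ) - 2 := by linarith
  have hA := optMatrix_transpose (n := n) κ
  have b1 : (optMatrix n κ * B).trace ≤ ∑ p : Pairs n, κ / (1 + κ) * (1 - c p) := by
    rw [trace_mul_eq_sum hA]
    refine Finset.sum_le_sum fun p _ => ?_
    obtain ⟨i, j, hij, rfl⟩ := exists_eq_mkPair p
    rw [← pairVec_eq_single hij]
    refine (dotProduct_le_norm_mul_norm _ _).trans ?_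
    rw [norm_optMatrix_pairVec hn hκ hr hij]
    exact mul_le_mul_of_nonneg_left (by linarith [hE i j hij]) (by positivity)
  have b2 : ∀ x ∈ triples n,
      (optMatrix n κ *ᵥ triVec x.1 x.2.1 x.2.2) ⬝ᵥ (B *ᵥ triVec x.1 x.2.1 x.2.2)
        ≤ 1 / (1 + κ) * (triVec x.1 x.2.1 x.2.2 ⬝ᵥ c.ofLp) := by
    rintro ⟨i, j, k⟩ hx
    have hik : i ≠ k := by simpa [triples] using hx
    by_cases hij : i = j
    · subst hij; simp [triVec_left]
    by_cases hjk : j = k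
    · subst hjk; simp [triVec_right]
    refine (dotProduct_le_norm_mul_norm _ _).trans ?_
    rw [norm_optMatrix_triVec hn hκ hr hij hjk hik]
    exact mul_le_mul_of_nonneg_left (hT i j k hij hjk hik) (by positivity)
  have b3 := Finset.sum_le_sum b2
  have b4 : ∑ x ∈ triples n, 1 / (1 + κ) * (triVec x.1 x.2.1 x.2.2 ⬝ᵥ c.ofLp)
      = 1 / (1 + κ) * ((2 * n - 4) * ∑ p, c p) := by
    rw [← Finset.mul_sum, sum_triVec_dotProduct]
  rw [b4] at b3
  rw [optInvSq_eq hn hκ, Matrix.add_mul, Matrix.add_mul, Matrix.trace_add, Matrix.smul_mul,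
    Matrix.smul_mul, Matrix.trace_smul, Matrix.one_mul, Matrix.smul_mul, Matrix.smul_mul,
    Matrix.trace_smul, Finset.sum_mul, Finset.sum_mul, Matrix.trace_sum]
  simp only [trace_vecMulVec_mul hA, smul_eq_mul]
  have b5 : ∑ p : Pairs n, κ / (1 + κ) * (1 - c p)
      = κ / (1 + κ) * (Fintype.card (Pairs n) - ∑ p, c p) := by
    rw [← Finset.mul_sum, Finset.sum_sub_distrib]
    congr 2
    simp [-Fintype.card_finset_len]
  rw [b5] at b1
  calc _ ≤ (1 + κ) / κ * (κ / (1 + κ) * (Fintype.card (Pairs n) - ∑ p, c p))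
        + (1 + κ) / (n - 2) / 2 * (1 / (1 + κ) * ((2 * n - 4) * ∑ p, c p)) := by gcongr
    _ = _ := by field_simp; ring

lemma constraints_of_affineBall_subset (hn : 3 ≤ n) {B : Matrix (Pairs n) (Pairs n) ℝ}
    (hB : Bᵀ = B) {c : PairSpace n} (h : affineBall B c ⊆ metricPolytope n) :
    (∀ i j : Fin n, ∀ h : i ≠ j, ‖WithLp.toLp 2 (B *ᵥ pairVec i j)‖ + c (mkPair h) ≤ 1) ∧
    ∀ i j k : Fin n, i ≠ j → j ≠ k → i ≠ k →
      ‖WithLp.toLp 2 (B *ᵥ triVec i j k)‖ ≤ triVec i j k ⬝ᵥ c.ofLp := by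
  constructor
  · intro i j hij
    rw [← pairVec_dotProduct hij c.ofLp]
    refine norm_mulVec_add_le_of_affineBall hB fun x hx => ?_
    rw [pairVec_dotProduct hij]
    exact ((mem_metricPolytope_iff hn x).1 (h hx)).1 _
  · intro i j k hij hjk hik
    have := norm_mulVec_add_le_of_affineBall hB (c := c) (a := -triVec i j k) (b := 0)
      fun x hx => by
        have := ((mem_metricPolytope_iff hn x).1 (h hx)).2 i j k hij hjk hik
        rw [neg_dotProduct]; linarith
    rw [Matrix.mulVec_neg, WithLp.toLp_neg, norm_neg, neg_dotProduct] at this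
    linarith

theorem isLargestEllipsoidIn_optMatrix (hn : 3 ≤ n) {κ : ℝ} (hκ : 0 < κ)
    (hr : ratioFun n κ = 0) :
    IsLargestEllipsoidIn (affineBall (optMatrix n κ) (constVec n (1 / (1 + κ))))
      (metricPolytope n) := by
  refine ⟨⟨_, _, optMatrix_posSemidef hn κ, rfl⟩, affineBall_optMatrix_subset hn hκ hr, ?_⟩
  rintro _ ⟨B, c, hB, rfl⟩ hsub hne
  by_contra hvol
  apply hne
  have hBt : Bᵀ = B := by
    rw [← Matrix.conjTranspose_eq_transpose_of_trivial]; exact hB.isHermitian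
  obtain ⟨hE, hT⟩ := constraints_of_affineBall_subset hn hBt hsub
  have htr := trace_le_of_affineBall_subset hn hκ hr hE hT
  have hdet : (optMatrix n κ).det ≤ B.det := by
    by_contra! hlt
    refine hvol (volume_affineBall_lt ?_ _ _)
    rwa [abs_of_nonneg hB.det_nonneg, abs_of_nonneg (optMatrix_posSemidef hn κ).det_nonneg]
  have hs : ∀ τ, 0 < τ → 0 < √√(eigSq κ τ) := fun τ hτ =>
    Real.sqrt_pos.2 (Real.sqrt_pos.2 (eigSq_pos hκ hτ))
  set C := johnson n √√(eigSq κ 1) √√(eigSq κ (tri₁ n)) √√(eigSq κ (tri₂ n)) with hC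
  set D := johnson n (√√(eigSq κ 1))⁻¹ (√√(eigSq κ (tri₁ n)))⁻¹ (√√(eigSq κ (tri₂ n)))⁻¹ with hD
  have hCC : C * C = optMatrix n κ := by
    rw [hC, johnson_mul hn, Real.mul_self_sqrt (Real.sqrt_nonneg _),
      Real.mul_self_sqrt (Real.sqrt_nonneg _), Real.mul_self_sqrt (Real.sqrt_nonneg _), optMatrix]
  have hDC : D * C = 1 := by
    rw [hC, hD, johnson_mul hn, inv_mul_cancel₀ (hs _ one_pos).ne',
      inv_mul_cancel₀ (hs _ (tri₁_pos hn)).ne', inv_mul_cancel₀ (hs _ (tri₂_pos hn)).ne',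
      johnson_one]
  have hDD : D * D = optInvSq n κ * optMatrix n κ := by
    rw [hD, johnson_mul hn, ← mul_inv, ← mul_inv, ← mul_inv, Real.mul_self_sqrt (Real.sqrt_nonneg _),
      Real.mul_self_sqrt (Real.sqrt_nonneg _), Real.mul_self_sqrt (Real.sqrt_nonneg _),
      ← optInv, ← optInv_mul_self hn hκ, Matrix.mul_assoc, optInv_mul hn hκ, Matrix.mul_one]
  have hBA : B = optMatrix n κ := by
    rw [← hCC] at hdet ⊢
    exact eq_of_trace_le_of_det_le hB (johnson_transpose _ _ _) hDC (hDD ▸ htr) hdet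
  subst hBA
  -- Tightness bounds every coordinate of `c` above; adding the two triangle inequalities with
  -- middle points `i` and `j` cancels the other two sides and bounds it below.
  have hcle : ∀ i j : Fin n, ∀ h : i ≠ j, c (mkPair h) ≤ 1 / (1 + κ) := fun i j h => by
    have := hE i j h
    rw [norm_optMatrix_pairVec hn hκ hr h] at this
    have e : 1 - κ / (1 + κ) = 1 / (1 + κ) := by field_simp; ring
    linarith
  have hcge : ∀ i j : Fin n, ∀ h : i ≠ j, 1 / (1 + κ) ≤ c (mkPair h) := fun i j h => by
    obtain ⟨k, hjk, hik⟩ := exists_ne_ne hn i j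
    have e1 := hT k i j hik.symm h hjk.symm
    have e2 := hT k j i hjk.symm h.symm hik.symm
    rw [norm_optMatrix_triVec hn hκ hr hik.symm h hjk.symm,
      triVec_dotProduct hik.symm h hjk.symm] at e1
    rw [norm_optMatrix_triVec hn hκ hr hjk.symm h.symm hik.symm,
      triVec_dotProduct hjk.symm h.symm hik.symm, mkPair_comm h] at e2
    linarith
  have hc : c = constVec n (1 / (1 + κ)) := by
    ext p
    obtain ⟨i, j, hij, rfl⟩ := exists_eq_mkPair p
    exact le_antisymm (hcle i j hij) (hcge i j hij)
  rw [hc]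

end Optimum

/-! ### The gauge of the ellipsoid on the polytope -/

section Inflation

variable {n : ℕ}

/-- The Minkowski functional of the optimal ellipsoid about its center. -/
noncomputable def optGauge (n : ℕ) (κ : ℝ) (x : PairSpace n) : ℝ :=
  ‖WithLp.toLp 2 (optInv n κ *ᵥ (x.ofLp - (constVec n (1 / (1 + κ))).ofLp))‖

lemma mem_inflate_iff (hn : 3 ≤ n) {κ : ℝ} (hκ : 0 < κ) {t : ℝ} (ht : 0 < t) (x : PairSpace n) :
    x ∈ inflate (constVec n (1 / (1 + κ))) t
      (affineBall (optMatrix n κ) (constVec n (1 / (1 + κ)))) ↔ optGauge n κ x ≤ t := by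
  set c := constVec n (1 / (1 + κ)) with hc
  have hRA := optInv_mul hn hκ
  have hAR : optMatrix n κ * optInv n κ = 1 := mul_eq_one_comm.1 hRA
  constructor
  · rintro ⟨_, ⟨u, hu, rfl⟩, rfl⟩
    have hu' : ‖u‖ ≤ 1 := by simpa using hu
    have e : (AffineMap.homothety c t ((optMatrix n κ).toEuclideanLin u + c)).ofLp - c.ofLp
        = t • (optMatrix n κ *ᵥ u.ofLp) := by
      simp [AffineMap.homothety_apply]
    have e2 : optGauge n κ (AffineMap.homothety c t ((optMatrix n κ).toEuclideanLin u + c))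
        = t * ‖u‖ := by
      rw [optGauge, ← hc, e, Matrix.mulVec_smul, Matrix.mulVec_mulVec, hRA, Matrix.one_mulVec,
        WithLp.toLp_smul, norm_smul, Real.norm_of_nonneg ht.le]
    exact e2.trans_le (mul_le_of_le_one_right ht.le hu')
  · intro h
    set v := optInv n κ *ᵥ (x.ofLp - c.ofLp) with hv
    have hv' : ‖WithLp.toLp 2 v‖ ≤ t := h
    refine ⟨(optMatrix n κ).toEuclideanLin (t⁻¹ • WithLp.toLp 2 v) + c,
      ⟨t⁻¹ • WithLp.toLp 2 v, ?_, rfl⟩, ?_⟩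
    · rw [mem_closedBall_zero_iff, norm_smul, Real.norm_of_nonneg (inv_nonneg.2 ht.le)]
      rw [inv_mul_le_iff₀ ht]
      simpa using hv'
    · have e : optMatrix n κ *ᵥ v = x.ofLp - c.ofLp := by
        rw [hv, Matrix.mulVec_mulVec, hAR, Matrix.one_mulVec]
      have e' : (optMatrix n κ).toEuclideanLin (WithLp.toLp 2 v) = x - c := by
        apply WithLp.ofLp_injective
        exact e
      rw [AffineMap.homothety_apply, map_smul, e']
      simp [smul_smul, mul_inv_cancel₀ ht.ne']

lemma isCompact_metricPolytope (hn : 3 ≤ n) : IsCompact (metricPolytope n) := by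
  have hset : metricPolytope n = {d | (∀ p, d p ≤ 1) ∧
      ∀ i j k : Fin n, i ≠ j → j ≠ k → i ≠ k → 0 ≤ triVec i j k ⬝ᵥ d.ofLp} :=
    Set.ext fun d => mem_metricPolytope_iff hn d
  apply Metric.isCompact_of_isClosed_isBounded
  · rw [hset]
    simp only [Set.ofPred_and, Set.ofPred_forall, dotProduct]
    refine IsClosed.inter (isClosed_iInter fun p => isClosed_le (by fun_prop) (by fun_prop)) ?_
    exact isClosed_iInter fun i => isClosed_iInter fun j => isClosed_iInter fun k =>
      isClosed_iInter fun _ => isClosed_iInter fun _ => isClosed_iInter fun _ =>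
        isClosed_le (by fun_prop) (by fun_prop)
  · refine (Metric.isBounded_closedBall (x := (0 : PairSpace n))
      (r := √(∑ _p : Pairs n, (1 : ℝ)))).subset fun d hd => ?_
    rw [mem_closedBall_zero_iff, EuclideanSpace.norm_eq]
    refine Real.sqrt_le_sqrt (Finset.sum_le_sum fun p _ => ?_)
    have := hd.2 p
    rw [Real.norm_of_nonneg this.1]
    nlinarith [this.1, this.2]

lemma continuous_optGauge (κ : ℝ) : Continuous (optGauge n κ) := by
  unfold optGauge
  refine continuous_norm.comp ((PiLp.continuous_toLp 2 _).comp ?_)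
  exact Continuous.matrix_mulVec continuous_const
    ((PiLp.continuous_ofLp 2 _).sub continuous_const)

lemma optGauge_sq (hn : 3 ≤ n) {κ : ℝ} (hκ : 0 < κ) (x : PairSpace n) :
    optGauge n κ x ^ 2 =
      (1 + κ) / κ * ∑ p, x p ^ 2 + (1 + κ) / (n - 2) / 2 *
        ∑ y ∈ triples n, (triVec y.1 y.2.1 y.2.2 ⬝ᵥ x.ofLp) ^ 2
      - 2 * (1 + κ) / κ * ∑ p, x p + Fintype.card (Pairs n) / κ := by
  have hn' : (3 : ℝ) ≤ n := by exact_mod_cast hn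
  have h2 : (n : ℝ) - 2 ≠ 0 := by linarith
  have hR : (optInv n κ)ᵀ = optInv n κ := johnson_transpose _ _ _
  rw [optGauge, norm_mulVec_sq hR, optInv_mul_self hn hκ, optInvSq_eq hn hκ]
  set c := constVec n (1 / (1 + κ)) with hc
  simp only [Matrix.add_mulVec, Matrix.smul_mulVec, dotProduct_add, dotProduct_smul,
    Matrix.one_mulVec, smul_eq_mul, Matrix.sum_mulVec, dotProduct_sum, Matrix.vecMulVec_mulVec]
  have e1 : (x.ofLp - c.ofLp) ⬝ᵥ (x.ofLp - c.ofLp) =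
      ∑ p, x p ^ 2 - 2 / (1 + κ) * ∑ p, x p + Fintype.card (Pairs n) / (1 + κ) ^ 2 := by
    have : ∀ p, (x.ofLp - c.ofLp) p * (x.ofLp - c.ofLp) p
        = x p ^ 2 - 2 / (1 + κ) * x p + 1 / (1 + κ) ^ 2 := fun p => by
      simp only [Pi.sub_apply, hc, constVec]
      field_simp
      ring
    simp only [dotProduct, this, Finset.sum_add_distrib, Finset.sum_sub_distrib, ← Finset.mul_sum,
      Finset.sum_const, Finset.card_univ, nsmul_eq_mul]
    ring
  have e2 : ∀ y ∈ triples n, MulOpposite.op (triVec y.1 y.2.1 y.2.2 ⬝ᵥ (x.ofLp - c.ofLp)) •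
      ((x.ofLp - c.ofLp) ⬝ᵥ triVec y.1 y.2.1 y.2.2) =
      (triVec y.1 y.2.1 y.2.2 ⬝ᵥ x.ofLp) ^ 2 - 2 / (1 + κ) * (triVec y.1 y.2.1 y.2.2 ⬝ᵥ x.ofLp)
        + 1 / (1 + κ) ^ 2 * (triVec y.1 y.2.1 y.2.2 ⬝ᵥ fun _ => 1) := by
    rintro ⟨i, j, k⟩ hy
    have hik : i ≠ k := by simpa [triples] using hy
    by_cases hij : i = j
    · subst hij; simp [triVec_left]
    by_cases hjk : j = k
    · subst hjk; simp [triVec_right]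
    rw [op_smul_eq_smul, dotProduct_comm _ (triVec i j k), dotProduct_sub,
      hc, triVec_dotProduct_constVec hij hjk hik, triVec_dotProduct hij hjk hik (fun _ => 1),
      smul_eq_mul]
    field_simp
    ring
  rw [Finset.sum_congr rfl e2, e1, Finset.sum_add_distrib, Finset.sum_sub_distrib, ← Finset.mul_sum,
    ← Finset.mul_sum, sum_triVec_dotProduct, sum_triVec_dotProduct]
  simp only [Finset.sum_const, Finset.card_univ, nsmul_eq_mul, mul_one]
  field_simp
  ring

/-- The bounds `s ^ 2 ≤ 2 * s` for the slacks `s` of the triangle inequalities and `d ^ 2 ≤ d` for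
the coordinates linearize the gauge. Both are equalities for cut metrics. -/
lemma optGauge_sq_le (hn : 3 ≤ n) {κ : ℝ} (hκ : 1 / 3 ≤ κ) (hκ1 : κ ≤ 1) {x : PairSpace n}
    (hx : x ∈ metricPolytope n) : optGauge n κ x ^ 2 ≤ 3 * Fintype.card (Pairs n) := by
  have hn' : (3 : ℝ) ≤ n := by exact_mod_cast hn
  have h2 : 0 < (n : ℝ) - 2 := by linarith
  have hκ0 : 0 < κ := by linarith
  have b1 : ∑ p, x p ^ 2 ≤ ∑ p, x p := Finset.sum_le_sum fun p _ => by
    nlinarith [(hx.2 p).1, (hx.2 p).2]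
  have b2 : ∑ y ∈ triples n, (triVec y.1 y.2.1 y.2.2 ⬝ᵥ x.ofLp) ^ 2
      ≤ 2 * ((2 * n - 4) * ∑ p, x p) := by
    rw [← sum_triVec_dotProduct, Finset.mul_sum]
    refine Finset.sum_le_sum fun y hy => ?_
    have := triVec_dotProduct_mem_Icc hn hx hy
    nlinarith [this.1, this.2]
  have b3 : ∑ p, x p ≤ Fintype.card (Pairs n) := by
    have : ∑ p, x p ≤ ∑ _p : Pairs n, (1 : ℝ) := Finset.sum_le_sum fun p _ => (hx.2 p).2
    simpa [-Fintype.card_finset_len] using this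
  have b4 : 0 ≤ ∑ p, x p := Finset.sum_nonneg fun p _ => (hx.2 p).1
  have b5 : optGauge n κ x ^ 2 ≤ (1 + κ) / κ * ∑ p, x p + (1 + κ) / (n - 2) / 2 *
      (2 * ((2 * n - 4) * ∑ p, x p)) - 2 * (1 + κ) / κ * ∑ p, x p
      + Fintype.card (Pairs n) / κ := by
    rw [optGauge_sq hn hκ0]
    gcongr
  refine b5.trans ?_
  generalize (∑ p, x p) = X at *
  generalize (Fintype.card (Pairs n) : ℝ) = N at *
  have e : (1 + κ) / κ * X + (1 + κ) / (n - 2) / 2 * (2 * ((2 * n - 4) * X))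
      - 2 * (1 + κ) / κ * X + N / κ = (X * (2 * κ ^ 2 + κ - 1) + N) / κ := by
    field_simp
    ring
  rw [e, div_le_iff₀ hκ0]
  -- The left side is affine in `X`, so it suffices to compare at `X = 0` and `X = N`.
  nlinarith [mul_nonneg b4 (sub_nonneg.2 hκ), mul_nonneg (sub_nonneg.2 b3) (sub_nonneg.2 hκ),
    mul_nonneg (mul_nonneg b4 hκ0.le) (sub_nonneg.2 hκ1)]

/-- The cut semimetric of the set of the `a` smallest points. -/
noncomputable def cutVec (n a : ℕ) : PairSpace n :=
  WithLp.toLp 2 fun p => if (p.1.filter fun i => i.1 < a).card = 1 then 1 else 0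

lemma cutVec_mkPair (a : ℕ) {i j : Fin n} (h : i ≠ j) :
    cutVec n a (mkPair h) = if (i.1 < a ↔ j.1 < a) then 0 else 1 := by
  by_cases hi : i.1 < a <;> by_cases hj : j.1 < a <;>
    simp [cutVec, mkPair, Finset.filter_insert, Finset.filter_singleton, hi, hj, h]

lemma cutVec_mem (hn : 3 ≤ n) (a : ℕ) : cutVec n a ∈ metricPolytope n := by
  rw [mem_metricPolytope_iff hn]
  constructor
  · intro p
    simp only [cutVec]
    split_ifs <;> norm_num
  · intro i j k hij hjk hik
    rw [triVec_dotProduct hij hjk hik]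
    simp only [cutVec_mkPair]
    by_cases hi : i.1 < a <;> by_cases hj : j.1 < a <;> by_cases hk : k.1 < a <;>
      simp [hi, hj, hk]

lemma cutVec_sq (a : ℕ) (p : Pairs n) : cutVec n a p ^ 2 = cutVec n a p := by
  simp only [cutVec]
  split_ifs <;> norm_num

lemma triVec_cutVec_sq (a : ℕ) {y : Fin n × Fin n × Fin n} (hy : y ∈ triples n) :
    (triVec y.1 y.2.1 y.2.2 ⬝ᵥ (cutVec n a).ofLp) ^ 2
      = 2 * (triVec y.1 y.2.1 y.2.2 ⬝ᵥ (cutVec n a).ofLp) := by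
  obtain ⟨i, j, k⟩ := y
  have hik : i ≠ k := by simpa [triples] using hy
  by_cases hij : i = j
  · subst hij; simp [triVec_left]
  by_cases hjk : j = k
  · subst hjk; simp [triVec_right]
  simp only [triVec_dotProduct hij hjk hik, cutVec_mkPair]
  by_cases hi : i.1 < a <;> by_cases hj : j.1 < a <;> by_cases hk : k.1 < a <;>
    simp [hi, hj, hk] <;> norm_num

lemma sum_cutVec {a : ℕ} (ha : a ≤ n) : ∑ p, cutVec n a p = a * (n - a) := by
  have h1 : ∑ i : Fin n, ∑ j, pairVec i j ⬝ᵥ (cutVec n a).ofLp = 2 * ∑ p, cutVec n a p := by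
    rw [Finset.sum_congr rfl fun i _ => (incidence_dotProduct i _).symm]
    simp only [dotProduct]
    rw [Finset.sum_comm, Finset.mul_sum]
    refine Finset.sum_congr rfl fun p _ => ?_
    rw [← Finset.sum_mul, sum_incidence]
  -- For the indicator `χ` of the set this is `χ i + χ j - 2 * χ i * χ j`, which is `0` at `i = j`.
  have h2 : ∀ i j : Fin n, pairVec i j ⬝ᵥ (cutVec n a).ofLp =
      (if i.1 < a then 1 else 0) + (if j.1 < a then 1 else 0)
        - 2 * ((if i.1 < a then 1 else 0) * (if j.1 < a then 1 else 0)) := fun i j => by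
    by_cases h : i = j
    · subst h
      by_cases hi : i.1 < a <;> simp [hi]
      norm_num
    · rw [pairVec_dotProduct h, cutVec_mkPair]
      by_cases hi : i.1 < a <;> by_cases hj : j.1 < a <;> simp [hi, hj]
      norm_num
  have h3 : ∑ i : Fin n, (if i.1 < a then (1 : ℝ) else 0) = a := by
    rw [Finset.sum_boole, Fin.card_filter_val_lt, min_eq_right ha]
  simp only [h2, Finset.sum_add_distrib, Finset.sum_sub_distrib, ← Finset.mul_sum,
    ← Finset.sum_mul, Finset.sum_const, Finset.card_univ, Fintype.card_fin, nsmul_eq_mul, h3] at h1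
  linarith

lemma optGauge_cutVec (hn : 3 ≤ n) {κ : ℝ} (hκ : 0 < κ) {a : ℕ} (ha : a ≤ n) :
    optGauge n κ (cutVec n a) ^ 2 =
      (a * (n - a) * (2 * κ ^ 2 + κ - 1) + n * (n - 1) / 2) / κ := by
  have hn' : (3 : ℝ) ≤ n := by exact_mod_cast hn
  have h2 : (n : ℝ) - 2 ≠ 0 := by linarith
  rw [optGauge_sq hn hκ, Finset.sum_congr rfl fun y hy => triVec_cutVec_sq a hy, ← Finset.mul_sum,
    sum_triVec_dotProduct, Finset.sum_congr rfl fun p _ => cutVec_sq a p, sum_cutVec ha, card_pairs]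
  field_simp
  ring

/-- The least inflation factor is the maximum of the gauge over the polytope. -/
theorem exists_isLeast_inflation (hn : 3 ≤ n) {κ : ℝ} (hκ : 0 < κ) (hr : ratioFun n κ = 0) :
    ∃ x ∈ metricPolytope n, (∀ y ∈ metricPolytope n, optGauge n κ y ≤ optGauge n κ x) ∧
      IsLeast {t : ℝ | 0 < t ∧
        affineBall (optMatrix n κ) (constVec n (1 / (1 + κ))) ⊆ metricPolytope n ∧
        metricPolytope n ⊆ inflate (constVec n (1 / (1 + κ))) t
          (affineBall (optMatrix n κ) (constVec n (1 / (1 + κ))))} (optGauge n κ x) := by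
  obtain ⟨x, hx, hmax⟩ := (isCompact_metricPolytope hn).exists_isMaxOn
    ⟨_, cutVec_mem hn 0⟩ (continuous_optGauge κ).continuousOn
  have hmax' : ∀ y ∈ metricPolytope n, optGauge n κ y ≤ optGauge n κ x := fun y hy => hmax hy
  have hpos : 0 < optGauge n κ x := by
    refine lt_of_lt_of_le ?_ (hmax' _ (cutVec_mem hn 0))
    refine lt_of_le_of_ne (norm_nonneg _) fun h => ?_
    have hn' : (3 : ℝ) ≤ n := by exact_mod_cast hn
    have h1 := optGauge_cutVec hn hκ (Nat.zero_le n)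
    rw [← h] at h1
    have h2 : 0 < (n : ℝ) * (n - 1) / 2 / κ :=
      div_pos (div_pos (mul_pos (by linarith) (by linarith)) two_pos) hκ
    rw [Nat.cast_zero, zero_mul, zero_mul, zero_add] at h1
    norm_num at h1
    linarith
  refine ⟨x, hx, hmax', ⟨hpos, affineBall_optMatrix_subset hn hκ hr, fun y hy => ?_⟩, ?_⟩
  · exact (mem_inflate_iff hn hκ hpos y).2 (hmax' y hy)
  · rintro t ⟨ht, -, hsub⟩
    exact (mem_inflate_iff hn hκ ht x).1 (hsub hx)

end Inflation

/-! ### The ratio of the optimal ellipsoid and its limit -/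

section Ratio

open Topology

variable {n : ℕ}

lemma weight₂_nonneg (hn : 3 ≤ n) : 0 ≤ weight₂ n := by
  have hn' : (3 : ℝ) ≤ n := by exact_mod_cast hn
  exact div_nonneg (by linarith) (by linarith)

lemma weight₁_pos (hn : 3 ≤ n) : 0 < weight₁ n := by
  have hn' : (3 : ℝ) ≤ n := by exact_mod_cast hn
  exact div_pos two_pos (by linarith)

lemma weight₀_pos (hn : 3 ≤ n) : 0 < weight₀ n := by
  have hn' : (3 : ℝ) ≤ n := by exact_mod_cast hn
  exact div_pos two_pos (mul_pos (by linarith) (by linarith))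

lemma ratioFun_strictAntiOn (hn : 3 ≤ n) : StrictAntiOn (ratioFun n) (Set.Ici 0) := by
  intro x hx y _ hxy
  have hx0 : 0 ≤ x := hx
  have hy0 : 0 < y := lt_of_le_of_lt hx0 hxy
  have t1 := tri₁_pos hn
  have t2 := tri₂_pos hn
  have a0 : weight₀ n / (1 + y) < weight₀ n / (1 + x) :=
    div_lt_div_of_pos_left (weight₀_pos hn) (by positivity) (by linarith)
  have a1 : weight₁ n / (1 + y * tri₁ n) ≤ weight₁ n / (1 + x * tri₁ n) :=
    div_le_div_of_nonneg_left (weight₁_pos hn).le (by positivity) (by gcongr)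
  have a2 : weight₂ n / (1 + y * tri₂ n) ≤ weight₂ n / (1 + x * tri₂ n) :=
    div_le_div_of_nonneg_left (weight₂_nonneg hn) (by positivity) (by gcongr)
  have a3 : x / (1 + x) ≤ y / (1 + y) := by
    rw [div_le_div_iff₀ (by positivity) (by positivity)]
    nlinarith
  unfold ratioFun
  linarith

/-- The bounds `2 ≤ tri₁ n ≤ 4` and `3 ≤ tri₂ n ≤ 5` locate the zero of `ratioFun n`. -/
lemma exists_ratioFun_eq_zero (hn : 3 ≤ n) : ∃ κ ∈ Set.Icc (1 / 3 : ℝ) 1, ratioFun n κ = 0 := by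
  have hn' : (3 : ℝ) ≤ n := by exact_mod_cast hn
  have hs := weight_sum hn
  have w0 := weight₀_pos hn
  have w1 := weight₁_pos hn
  have w2 := weight₂_nonneg hn
  have t1 := tri₁_pos hn
  have t2 := tri₂_pos hn
  have t1' : tri₁ n ≤ 4 := by
    unfold tri₁; rw [div_le_iff₀ (by linarith)]; linarith
  have t2' : tri₂ n ≤ 5 := by
    unfold tri₂; rw [div_le_iff₀ (by linarith)]; linarith
  have t1'' : 2 ≤ tri₁ n := by
    unfold tri₁; rw [le_div_iff₀ (by linarith)]; linarith
  have t2'' : 3 ≤ tri₂ n := by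
    unfold tri₂; rw [le_div_iff₀ (by linarith)]; linarith
  have hcont : ContinuousOn (ratioFun n) (Set.Icc (1 / 3 : ℝ) 1) := by
    unfold ratioFun
    have hpos : ∀ x ∈ Set.Icc (1 / 3 : ℝ) 1, 0 < x := fun x hx => by linarith [hx.1]
    refine (((ContinuousOn.div ?_ ?_ ?_).add (ContinuousOn.div ?_ ?_ ?_)).add
      (ContinuousOn.div ?_ ?_ ?_)).sub (ContinuousOn.div ?_ ?_ ?_)
    all_goals first
      | fun_prop
      | (intro x hx; have := hpos x hx; positivity)
  have hlow : 0 ≤ ratioFun n (1 / 3) := by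
    unfold ratioFun
    have a0 : weight₀ n / 4 ≤ weight₀ n / (1 + 1 / 3) :=
      div_le_div_of_nonneg_left w0.le (by norm_num) (by norm_num)
    have a1 : weight₁ n / 4 ≤ weight₁ n / (1 + 1 / 3 * tri₁ n) :=
      div_le_div_of_nonneg_left w1.le (by positivity) (by linarith)
    have a2 : weight₂ n / 4 ≤ weight₂ n / (1 + 1 / 3 * tri₂ n) :=
      div_le_div_of_nonneg_left w2 (by positivity) (by linarith)
    norm_num at *
    linarith
  have hhigh : ratioFun n 1 ≤ 0 := by
    unfold ratioFun
    have a1 : weight₁ n / (1 + 1 * tri₁ n) ≤ weight₁ n / 2 :=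
      div_le_div_of_nonneg_left w1.le two_pos (by linarith)
    have a2 : weight₂ n / (1 + 1 * tri₂ n) ≤ weight₂ n / 2 :=
      div_le_div_of_nonneg_left w2 two_pos (by linarith)
    have e : (1 : ℝ) / (1 + 1) = 1 / 2 := by norm_num
    have e' : weight₀ n / (1 + 1) = weight₀ n / 2 := by norm_num
    rw [e, e']
    linarith
  obtain ⟨κ, hκ, h⟩ := intermediate_value_Icc' (by norm_num) hcont ⟨hhigh, hlow⟩
  exact ⟨κ, hκ, h⟩

lemma tendsto_natCast_div_sub (a : ℝ) : Tendsto (fun n : ℕ => (n : ℝ) / (n - a)) atTop (𝓝 1) := by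
  have h : Tendsto (fun n : ℕ => (1 - a * (n : ℝ)⁻¹)⁻¹) atTop (𝓝 (1 - a * 0)⁻¹) :=
    ((tendsto_inv_atTop_nhds_zero_nat.const_mul a).const_sub 1).inv₀ (by simp)
  simp only [mul_zero, sub_zero, inv_one] at h
  refine h.congr' ?_
  filter_upwards [eventually_gt_atTop 0] with n hn
  have hn' : (n : ℝ) ≠ 0 := by positivity
  have e : 1 - a * (n : ℝ)⁻¹ = (n - a) / n := by field_simp
  rw [e, inv_div]

lemma tendsto_const_div_natCast_sub (a b : ℝ) :
    Tendsto (fun n : ℕ => b / ((n : ℝ) - a)) atTop (𝓝 0) :=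
  (tendsto_atTop_add_const_right _ (-a) tendsto_natCast_atTop_atTop).const_div_atTop b

lemma tendsto_weight₁ : Tendsto weight₁ atTop (𝓝 0) := by
  refine (tendsto_const_div_natCast_sub 0 2).congr fun n => ?_
  rw [sub_zero, weight₁]

lemma tendsto_weight₀ : Tendsto weight₀ atTop (𝓝 0) := by
  have := tendsto_weight₁.mul (tendsto_const_div_natCast_sub 1 1)
  rw [zero_mul] at this
  refine this.congr fun n => ?_
  unfold weight₁ weight₀
  rw [div_mul_div_comm, mul_one]

lemma tendsto_weight₂ : Tendsto weight₂ atTop (𝓝 1) := by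
  have := (tendsto_natCast_div_sub 1).sub (tendsto_const_div_natCast_sub 1 3)
  rw [sub_zero] at this
  exact this.congr fun n => (sub_div _ _ _).symm

lemma tendsto_tri₁ : Tendsto tri₁ atTop (𝓝 2) := by
  have := ((tendsto_natCast_div_sub 2).const_mul 2).sub (tendsto_const_div_natCast_sub 2 2)
  rw [sub_zero, mul_one] at this
  refine this.congr fun n => ?_
  unfold tri₁
  ring

lemma tendsto_tri₂ : Tendsto tri₂ atTop (𝓝 3) := by
  have := ((tendsto_natCast_div_sub 2).const_mul 3).sub (tendsto_const_div_natCast_sub 2 4)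
  rw [sub_zero, mul_one] at this
  refine this.congr fun n => ?_
  unfold tri₂
  ring

lemma tendsto_ratioFun {x : ℝ} (hx : 0 < x) :
    Tendsto (fun n => ratioFun n x) atTop (𝓝 (1 / (1 + x * 3) - x / (1 + x))) := by
  have := (((tendsto_weight₀.div_const (1 + x)).add (tendsto_weight₁.div
    ((tendsto_tri₁.const_mul x).const_add 1) (by positivity))).add (tendsto_weight₂.div
    ((tendsto_tri₂.const_mul x).const_add 1) (by positivity))).sub_const (x / (1 + x))
  simpa [ratioFun] using this

/-- In the limit the ratio solves `1 / (1 + 3 κ) = κ / (1 + κ)`, that is, `3 κ² = 1`. -/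
lemma tendsto_ratio {κ : ℕ → ℝ} (hκ : ∀ n, 3 ≤ n → κ n ∈ Set.Icc (1 / 3 : ℝ) 1 ∧
    ratioFun n (κ n) = 0) : Tendsto κ atTop (𝓝 (1 / √3)) := by
  have h3 : (√3) ^ 2 = 3 := Real.sq_sqrt (by norm_num)
  have h3' : 0 < √3 := by positivity
  have hsol : ∀ x : ℝ, 0 < x → 1 / (1 + x * 3) - x / (1 + x)
      = (1 - 3 * x ^ 2) / ((1 + x * 3) * (1 + x)) := fun x hx => by
    field_simp
    ring
  rw [tendsto_order]
  constructor
  · intro a ha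
    by_cases ha0 : a ≤ 0
    · filter_upwards [eventually_ge_atTop 3] with n hn
      linarith [(hκ n hn).1.1]
    push Not at ha0
    have hlim : 0 < 1 / (1 + a * 3) - a / (1 + a) := by
      rw [hsol a ha0]
      rw [lt_div_iff₀ h3'] at ha
      refine div_pos ?_ (by positivity)
      nlinarith [mul_pos ha0 h3']
    filter_upwards [eventually_ge_atTop 3, (tendsto_ratioFun ha0).eventually_const_lt hlim]
      with n hn h
    by_contra! hle
    have h0 : 0 ≤ κ n := by linarith [(hκ n hn).1.1]
    have := (ratioFun_strictAntiOn hn).antitoneOn h0 ha0.le hle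
    rw [(hκ n hn).2] at this
    linarith
  · intro b hb
    have hb0 : 0 < b := lt_trans (by positivity) hb
    have hlim : 1 / (1 + b * 3) - b / (1 + b) < 0 := by
      rw [hsol b hb0]
      rw [gt_iff_lt, div_lt_iff₀ h3'] at hb
      refine div_neg_of_neg_of_pos ?_ (by positivity)
      nlinarith [mul_pos hb0 h3']
    filter_upwards [eventually_ge_atTop 3, (tendsto_ratioFun hb0).eventually_lt_const hlim]
      with n hn h
    by_contra! hle
    have h0 : 0 ≤ κ n := by linarith [(hκ n hn).1.1]
    have := (ratioFun_strictAntiOn hn).antitoneOn hb0.le h0 hle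
    rw [(hκ n hn).2] at this
    linarith

end Ratio

/-! ### Asymptotics of the entries and of the inflation factor -/

section Asymptotics

open Topology

lemma isLittleO_sub_of_tendsto {f : ℕ → ℝ} {L : ℝ} (k : ℕ)
    (h : Tendsto (fun n : ℕ => (n : ℝ) ^ k * f n) atTop (𝓝 L)) :
    (fun n : ℕ => f n - L * (1 / (n : ℝ) ^ k)) =o[atTop] fun n : ℕ => 1 / (n : ℝ) ^ k := by
  have hne : ∀ᶠ n : ℕ in atTop, (n : ℝ) ^ k ≠ 0 := by
    filter_upwards [eventually_gt_atTop 0] with n hn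
    positivity
  rw [isLittleO_iff_tendsto' (hne.mono fun n hn h0 => absurd h0 (one_div_ne_zero hn))]
  have := h.sub_const L
  rw [sub_self] at this
  refine this.congr' (hne.mono fun n hn => ?_)
  field_simp

lemma isLittleO_natCast_of_tendsto {f : ℕ → ℝ} {L : ℝ}
    (h : Tendsto (fun n : ℕ => f n / n) atTop (𝓝 L)) :
    (fun n : ℕ => f n - L * n) =o[atTop] fun n : ℕ => (n : ℝ) := by
  have hne : ∀ᶠ n : ℕ in atTop, (n : ℝ) ≠ 0 := by
    filter_upwards [eventually_gt_atTop 0] with n hn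
    positivity
  rw [isLittleO_iff_tendsto' (hne.mono fun n hn h0 => absurd h0 hn)]
  have := h.sub_const L
  rw [sub_self] at this
  refine this.congr' (hne.mono fun n hn => ?_)
  field_simp

lemma tendsto_sq_mul_onesCoeff {l₀ l₁ l₂ : ℕ → ℝ} {L₀ L₁ L₂ : ℝ} (h₀ : Tendsto l₀ atTop (𝓝 L₀))
    (h₁ : Tendsto l₁ atTop (𝓝 L₁)) (h₂ : Tendsto l₂ atTop (𝓝 L₂)) :
    Tendsto (fun n : ℕ => (n : ℝ) ^ 2 * onesCoeff n (l₀ n) (l₁ n) (l₂ n)) atTop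
      (𝓝 (2 * (L₀ - L₂) - 4 * (L₁ - L₂))) := by
  have h := (((tendsto_natCast_div_sub 1).const_mul 2).mul (h₀.sub h₂)).sub
    (((tendsto_natCast_div_sub 2).const_mul 4).mul (h₁.sub h₂))
  simp only [mul_one] at h
  refine h.congr' ?_
  filter_upwards [eventually_gt_atTop 0] with n hn
  have hn' : (n : ℝ) ≠ 0 := by positivity
  have e : (n : ℝ) ^ 2 * onesCoeff n (l₀ n) (l₁ n) (l₂ n)
      = n * 2 * (n * (n : ℝ)⁻¹) * ((l₀ n - l₂ n) / (n - 1) - 2 * ((l₁ n - l₂ n) / (n - 2))) := by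
    unfold onesCoeff; ring
  rw [e, mul_inv_cancel₀ hn']
  ring

lemma tendsto_onesCoeff {l₀ l₁ l₂ : ℕ → ℝ} {L₀ L₁ L₂ : ℝ} (h₀ : Tendsto l₀ atTop (𝓝 L₀))
    (h₁ : Tendsto l₁ atTop (𝓝 L₁)) (h₂ : Tendsto l₂ atTop (𝓝 L₂))
    {k : ℕ} (hk : k < 2) :
    Tendsto (fun n : ℕ => (n : ℝ) ^ k * onesCoeff n (l₀ n) (l₁ n) (l₂ n)) atTop (𝓝 0) := by
  have h := (tendsto_sq_mul_onesCoeff h₀ h₁ h₂).mul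
    ((tendsto_inv_atTop_nhds_zero_nat (𝕜 := ℝ)).pow (2 - k))
  rw [zero_pow (by omega), mul_zero] at h
  refine h.congr' ?_
  filter_upwards [eventually_gt_atTop 0] with n hn
  have hn' : (n : ℝ) ≠ 0 := by positivity
  rw [mul_right_comm]
  congr 1
  rw [inv_pow, mul_inv_eq_iff_eq_mul₀ (pow_ne_zero _ hn'), ← pow_add]
  congr 1
  omega

lemma tendsto_mul_second_entry {l₀ l₁ l₂ : ℕ → ℝ} {L₀ L₁ L₂ : ℝ} (h₀ : Tendsto l₀ atTop (𝓝 L₀))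
    (h₁ : Tendsto l₁ atTop (𝓝 L₁)) (h₂ : Tendsto l₂ atTop (𝓝 L₂)) :
    Tendsto (fun n : ℕ => (n : ℝ) * ((l₁ n - l₂ n) / (n - 2) + onesCoeff n (l₀ n) (l₁ n) (l₂ n)))
      atTop (𝓝 (L₁ - L₂)) := by
  have h := ((tendsto_natCast_div_sub 2).mul (h₁.sub h₂)).add
    (tendsto_onesCoeff h₀ h₁ h₂ (k := 1) one_lt_two)
  rw [one_mul, add_zero] at h
  refine h.congr fun n => ?_
  rw [pow_one]
  ring

lemma tendsto_first_entry {l₀ l₁ l₂ : ℕ → ℝ} {L₀ L₁ L₂ : ℝ} (h₀ : Tendsto l₀ atTop (𝓝 L₀))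
    (h₁ : Tendsto l₁ atTop (𝓝 L₁)) (h₂ : Tendsto l₂ atTop (𝓝 L₂)) :
    Tendsto (fun n : ℕ => l₂ n + 2 * ((l₁ n - l₂ n) / (n - 2)) +
      onesCoeff n (l₀ n) (l₁ n) (l₂ n)) atTop (𝓝 L₂) := by
  have h := (h₂.add (((tendsto_const_div_natCast_sub 2 1).mul (h₁.sub h₂)).const_mul 2)).add
    (tendsto_onesCoeff h₀ h₁ h₂ (k := 0) two_pos)
  rw [zero_mul, mul_zero, add_zero, add_zero] at h
  refine h.congr fun n => ?_
  rw [pow_zero]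
  ring

lemma sqrt_three_bounds : 1.7320508 < √3 ∧ √3 < 1.7320509 := by
  constructor
  · exact Real.lt_sqrt_of_sq_lt (by norm_num)
  · rw [Real.sqrt_lt' (by norm_num)]; norm_num

lemma tendsto_sqrt_eigSq {κ τ : ℕ → ℝ} {t L : ℝ} (hκ : Tendsto κ atTop (𝓝 (1 / √3)))
    (hτ : Tendsto τ atTop (𝓝 t)) (ht : 0 < t) (hL : 0 ≤ L) (h : eigSq (1 / √3) t = L ^ 2) :
    Tendsto (fun n => √(eigSq (κ n) (τ n))) atTop (𝓝 L) := by
  have := (hκ.div ((hκ.const_add 1).mul ((hκ.mul hτ).const_add 1)) (by positivity)).sqrt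
  rw [← eigSq, h, Real.sqrt_sq hL] at this
  exact this

/-- The limits of the squared eigenvalues in units of `((√3 - 1) / 2) ^ 2`: here `u` is `√3`,
`3 - √3` and `1` for `t = 1, 2, 3`. -/
lemma eigSq_limit {t u : ℝ} (ht : 0 < t) (h : u * (√3 + t) = (√3 + 1) * √3) :
    eigSq (1 / √3) t = ((√3 - 1) / 2) ^ 2 * u := by
  have h3 : (√3) ^ 2 = 3 := Real.sq_sqrt (by norm_num)
  have h3' : 0 < √3 := by positivity
  have hu : u = (√3 + 1) * √3 / (√3 + t) := by field_simp; linarith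
  have e : eigSq (1 / √3) t = √3 / ((√3 + 1) * (√3 + t)) := by
    unfold eigSq; field_simp
  have e2 : ((√3 - 1) / 2) ^ 2 = 1 / (√3 + 1) ^ 2 := by
    rw [eq_div_iff (by positivity)]
    linear_combination (√3 ^ 2 + 1) / 4 * h3
  rw [e, e2, hu]
  field_simp

lemma sqrt_three_sub_bounds : 1.126032 < √(3 - √3) ∧ √(3 - √3) < 1.126033 := by
  obtain ⟨h1, h2⟩ := sqrt_three_bounds
  constructor
  · exact Real.lt_sqrt_of_sq_lt (by norm_num at *; linarith)
  · rw [Real.sqrt_lt' (by norm_num)]; norm_num at *; linarith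

lemma sqrt_sqrt_three_bounds : 1.316074 < √√3 ∧ √√3 < 1.316075 := by
  obtain ⟨h1, h2⟩ := sqrt_three_bounds
  constructor
  · exact Real.lt_sqrt_of_sq_lt (by norm_num at *; linarith)
  · rw [Real.sqrt_lt' (by norm_num)]; norm_num at *; linarith

lemma rpow_quarter : (3 : ℝ) ^ (1 / 4 : ℝ) = √√3 := by
  rw [Real.sqrt_eq_rpow, Real.sqrt_eq_rpow, ← Real.rpow_mul (by norm_num)]
  norm_num

lemma cut_coefficient_eq : (3 : ℝ) ^ (3 / 4 : ℝ) * √(5 + √3) / 6 = √((3 + 5 * √3) / 12) := by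
  have h3 : (√3) ^ 2 = 3 := Real.sq_sqrt (by norm_num)
  have h1 : (3 : ℝ) ^ (3 / 4 : ℝ) = √(3 * √3) := by
    rw [Real.sqrt_mul (by norm_num), ← rpow_quarter, Real.sqrt_eq_rpow,
      ← Real.rpow_add (by norm_num)]
    norm_num
  symm
  rw [Real.sqrt_eq_iff_mul_self_eq (by positivity) (by positivity), h1,
    ← Real.sqrt_mul (by positivity), ← sq, div_pow, Real.sq_sqrt (by positivity)]
  linear_combination (-1 / 12) * h3

lemma tendsto_half_div : Tendsto (fun n : ℕ => ((n / 2 : ℕ) : ℝ) / n) atTop (𝓝 (1 / 2)) := by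
  have hlow : Tendsto (fun n : ℕ => 1 / 2 - (n : ℝ)⁻¹) atTop (𝓝 (1 / 2)) := by
    have := (tendsto_inv_atTop_nhds_zero_nat (𝕜 := ℝ)).const_sub (1 / 2)
    rwa [sub_zero] at this
  refine tendsto_of_tendsto_of_tendsto_of_le_of_le' hlow tendsto_const_nhds ?_ ?_
  · filter_upwards [eventually_gt_atTop 0] with n hn
    have hn' : 0 < (n : ℝ) := by positivity
    have h : (n : ℝ) ≤ 2 * (n / 2 : ℕ) + 1 := by exact_mod_cast (by omega)
    rw [le_div_iff₀ hn', sub_mul, inv_mul_cancel₀ hn'.ne']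
    linarith
  · filter_upwards [eventually_gt_atTop 0] with n hn
    have hn' : 0 < (n : ℝ) := by positivity
    have h : 2 * ((n / 2 : ℕ) : ℝ) ≤ n := by exact_mod_cast (by omega)
    rw [div_le_iff₀ hn']
    linarith

/-- The gauge of a balanced cut semimetric, divided by `n`, converges. -/
lemma tendsto_cut_gauge {κ : ℕ → ℝ} (hκ : Tendsto κ atTop (𝓝 (1 / √3))) :
    Tendsto (fun n : ℕ => √((((n / 2 : ℕ) : ℝ) * (n - (n / 2 : ℕ)) * (2 * κ n ^ 2 + κ n - 1)
      + n * (n - 1) / 2) / κ n) / n) atTop (𝓝 ((3 : ℝ) ^ (3 / 4 : ℝ) * √(5 + √3) / 6)) := by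
  have h3 : (√3) ^ 2 = 3 := Real.sq_sqrt (by norm_num)
  have h3' : 0 < √3 := by positivity
  have hinv : Tendsto (fun n : ℕ => (n : ℝ)⁻¹) atTop (𝓝 0) := tendsto_inv_atTop_nhds_zero_nat
  have h := (((tendsto_half_div.mul (tendsto_half_div.const_sub 1)).mul
    ((((hκ.pow 2).const_mul 2).add hκ).sub_const 1)).add
    ((hinv.const_sub 1).div_const 2)).div hκ (by positivity)
  have hlim : (1 / 2 * (1 - 1 / 2) * (2 * (1 / √3) ^ 2 + 1 / √3 - 1) + (1 - 0) / 2) / (1 / √3)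
      = (3 + 5 * √3) / 12 := by
    field_simp
    rw [h3]
    ring_nf
    linarith
  rw [hlim] at h
  rw [cut_coefficient_eq]
  refine h.sqrt.congr' ?_
  filter_upwards [eventually_gt_atTop 0] with n hn
  have hn' : 0 < (n : ℝ) := by positivity
  rw [← Real.sqrt_sq hn'.le, ← Real.sqrt_div' _ (by positivity), Real.sqrt_sq hn'.le]
  congr 1
  simp only [Pi.div_apply]
  field_simp

lemma tendsto_sqrt_three_mul_choose :
    Tendsto (fun n : ℕ => √(3 * (n.choose 2 : ℝ)) / n) atTop (𝓝 √(3 / 2)) := by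
  have hinv : Tendsto (fun n : ℕ => (n : ℝ)⁻¹) atTop (𝓝 0) := tendsto_inv_atTop_nhds_zero_nat
  have h := ((hinv.const_sub 1).const_mul (3 / 2)).sqrt
  rw [sub_zero, mul_one] at h
  refine h.congr' ?_
  filter_upwards [eventually_gt_atTop 0] with n hn
  have hn' : 0 < (n : ℝ) := by positivity
  rw [← Real.sqrt_sq hn'.le, ← Real.sqrt_div' _ (by positivity), Real.sqrt_sq hn'.le,
    Nat.cast_choose_two]
  congr 1
  field_simp

end Asymptotics

theorem theorem2 :
    ∃ α β γ δ r : ℕ → ℝ,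
      -- the largest ellipsoid and the smallest inflation factor, for every `n ≥ 3`
      (∀ n : ℕ, 3 ≤ n →
        (pairMatrix n (α n) (β n) (γ n)).PosSemidef ∧
        IsLargestEllipsoidIn
          (affineBall (pairMatrix n (α n) (β n) (γ n)) (constVec n (δ n))) (metricPolytope n) ∧
        IsLeast
          {t : ℝ | 0 < t ∧
            affineBall (pairMatrix n (α n) (β n) (γ n)) (constVec n (δ n)) ⊆ metricPolytope n ∧
            metricPolytope n ⊆ inflate (constVec n (δ n)) t
              (affineBall (pairMatrix n (α n) (β n) (γ n)) (constVec n (δ n)))}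
          (r n)) ∧
      -- asymptotics of the parameters
      (fun n : ℕ => α n - (√3 - 1) / 2) =o[atTop] (fun _ : ℕ => (1 : ℝ)) ∧
      (fun n : ℕ => β n - (√3 - 1) / 2 * (√(3 - √3) - 1) * (1 / (n : ℝ)))
        =o[atTop] (fun n : ℕ => 1 / (n : ℝ)) ∧
      (fun n : ℕ => γ n - (√3 - 1) / 2 * (2 * (3 : ℝ) ^ (1 / 4 : ℝ) + 2 - 4 * √(3 - √3))
          * (1 / (n : ℝ) ^ 2))
        =o[atTop] (fun n : ℕ => 1 / (n : ℝ) ^ 2) ∧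
      (fun n : ℕ => δ n - (√3 - 1) / 2 * √3) =o[atTop] (fun _ : ℕ => (1 : ℝ)) ∧
      -- bounds for the smallest inflation factor
      (∃ e : ℕ → ℝ, e =o[atTop] (fun n : ℕ => (n : ℝ)) ∧
        ∀ n : ℕ, 3 ≤ n → (3 : ℝ) ^ (3 / 4 : ℝ) * √(5 + √3) / 6 * n + e n ≤ r n) ∧
      (∃ e : ℕ → ℝ, e =o[atTop] (fun n : ℕ => (n : ℝ)) ∧
        ∀ n : ℕ, 3 ≤ n → r n ≤ √(3 * (n.choose 2 : ℝ)) + e n) ∧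
      -- the decimal approximations
      |(√3 - 1) / 2 - 0.3660| ≤ 0.00005 ∧
      |(√3 - 1) / 2 * (√(3 - √3) - 1) - 0.0461| ≤ 0.00005 ∧
      |(√3 - 1) / 2 * (2 * (3 : ℝ) ^ (1 / 4 : ℝ) + 2 - 4 * √(3 - √3)) - 0.0469| ≤ 0.00005 ∧
      |(√3 - 1) / 2 * √3 - 0.6340| ≤ 0.00005 ∧
      |(3 : ℝ) ^ (3 / 4 : ℝ) * √(5 + √3) / 6 - 0.99| ≤ 0.005 ∧
      (fun n : ℕ => √(3 * (n.choose 2 : ℝ)) - √(3 / 2) * n) =o[atTop] (fun n : ℕ => (n : ℝ)) ∧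
      |√(3 / 2) - (1.22 : ℝ)| ≤ 0.005 := by
  have h3 : (√3) ^ 2 = 3 := Real.sq_sqrt (by norm_num)
  obtain ⟨h3l, h3u⟩ := sqrt_three_bounds
  have hκex : ∀ n : ℕ, ∃ κ : ℝ, 3 ≤ n → κ ∈ Set.Icc (1 / 3 : ℝ) 1 ∧ ratioFun n κ = 0 := fun n => by
    by_cases hn : 3 ≤ n
    · obtain ⟨κ, hκ, h⟩ := exists_ratioFun_eq_zero hn
      exact ⟨κ, fun _ => ⟨hκ, h⟩⟩
    · exact ⟨0, fun h => absurd h hn⟩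
  -- Values at `n < 3` are arbitrary.
  choose κ hκ using hκex
  have hκpos : ∀ n, 3 ≤ n → 0 < κ n := fun n hn => by linarith [(hκ n hn).1.1]
  have hlim := tendsto_ratio hκ
  have hrex : ∀ n : ℕ, ∃ r : ℝ, 3 ≤ n → (∃ x ∈ metricPolytope n, optGauge n (κ n) x = r) ∧
      (∀ y ∈ metricPolytope n, optGauge n (κ n) y ≤ r) ∧
      IsLeast {t : ℝ | 0 < t ∧
        affineBall (optMatrix n (κ n)) (constVec n (1 / (1 + κ n))) ⊆ metricPolytope n ∧
        metricPolytope n ⊆ inflate (constVec n (1 / (1 + κ n))) t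
          (affineBall (optMatrix n (κ n)) (constVec n (1 / (1 + κ n))))} r := fun n => by
    by_cases hn : 3 ≤ n
    · obtain ⟨x, hx, hmax, hleast⟩ := exists_isLeast_inflation hn (hκpos n hn) (hκ n hn).2
      exact ⟨_, fun _ => ⟨⟨x, hx, rfl⟩, hmax, hleast⟩⟩
    · exact ⟨0, fun h => absurd h hn⟩
  choose r hr using hrex
  have hs : 0 ≤ 3 - √3 := by linarith
  have l₀ := tendsto_sqrt_eigSq (L := (√3 - 1) / 2 * √√3) hlim
    (tendsto_const_nhds (x := (1 : ℝ))) one_pos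
    (mul_nonneg (by linarith) (Real.sqrt_nonneg _))
    (by rw [mul_pow, Real.sq_sqrt (by positivity)]
        exact eigSq_limit one_pos (by ring))
  have l₁ := tendsto_sqrt_eigSq (L := (√3 - 1) / 2 * √(3 - √3)) hlim tendsto_tri₁ two_pos
    (mul_nonneg (by linarith) (Real.sqrt_nonneg _))
    (by rw [mul_pow, Real.sq_sqrt hs]
        exact eigSq_limit two_pos (by linear_combination -2 * h3))
  have l₂ := tendsto_sqrt_eigSq (L := (√3 - 1) / 2) hlim tendsto_tri₂ three_pos (by linarith)
    (by rw [eigSq_limit three_pos (u := 1) (by linear_combination -h3), mul_one])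
  obtain ⟨u, hu⟩ : ∃ u : ℕ → ℝ, u = fun n => √(eigSq (κ n) 1) := ⟨_, rfl⟩
  obtain ⟨v, hv⟩ : ∃ v : ℕ → ℝ, v = fun n => √(eigSq (κ n) (tri₁ n)) := ⟨_, rfl⟩
  obtain ⟨w, hw⟩ : ∃ w : ℕ → ℝ, w = fun n => √(eigSq (κ n) (tri₂ n)) := ⟨_, rfl⟩
  have hopt : ∀ n, pairMatrix n (w n + 2 * ((v n - w n) / (n - 2)) + onesCoeff n (u n) (v n) (w n))
      ((v n - w n) / (n - 2) + onesCoeff n (u n) (v n) (w n)) (onesCoeff n (u n) (v n) (w n))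
      = optMatrix n (κ n) := fun n => by
    rw [← johnson_eq_pairMatrix, hu, hv, hw, optMatrix]
  rw [← hu] at l₀
  rw [← hv] at l₁
  rw [← hw] at l₂
  refine ⟨fun n => w n + 2 * ((v n - w n) / (n - 2)) + onesCoeff n (u n) (v n) (w n),
    fun n => (v n - w n) / (n - 2) + onesCoeff n (u n) (v n) (w n),
    fun n => onesCoeff n (u n) (v n) (w n), fun n => 1 / (1 + κ n), r, fun n hn => ?_,
    ?_, ?_, ?_, ?_, ?_, ?_, ?_, ?_, ?_, ?_, ?_, ?_, ?_⟩
  · simp only [hopt]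
    exact ⟨optMatrix_posSemidef hn _, isLargestEllipsoidIn_optMatrix hn (hκpos n hn) (hκ n hn).2,
      (hr n hn).2.2⟩
  · rw [isLittleO_one_iff]
    exact (sub_self ((√3 - 1) / 2)) ▸ (tendsto_first_entry l₀ l₁ l₂).sub_const _
  · have h := isLittleO_sub_of_tendsto 1 (by simpa using tendsto_mul_second_entry l₀ l₁ l₂)
    simp only [pow_one] at h
    refine h.congr_left fun n => ?_
    ring
  · refine (isLittleO_sub_of_tendsto 2 (tendsto_sq_mul_onesCoeff l₀ l₁ l₂)).congr_left fun n => ?_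
    rw [rpow_quarter]
    ring
  · rw [isLittleO_one_iff]
    have h := ((hlim.const_add 1).inv₀ (by positivity)).sub_const ((√3 - 1) / 2 * √3)
    have e : (1 + 1 / √3)⁻¹ - (√3 - 1) / 2 * √3 = 0 := by
      have : 0 < √3 := by positivity
      field_simp
      linear_combination -√3 * h3
    rw [e] at h
    simpa only [one_div] using h
  · refine ⟨_, isLittleO_natCast_of_tendsto (tendsto_cut_gauge hlim), fun n hn => ?_⟩
    have h := (hr n hn).2.1 _ (cutVec_mem hn (n / 2))
    rw [← optGauge_cutVec hn (hκpos n hn) (Nat.div_le_self n 2), Real.sqrt_sq (show 0 ≤ optGauge n (κ n) _ from norm_nonneg _)]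
    linarith
  · refine ⟨fun _ => 0, isLittleO_zero _ _, fun n hn => ?_⟩
    obtain ⟨x, hx, hxr⟩ := (hr n hn).1
    rw [add_zero, ← hxr]
    refine Real.le_sqrt_of_sq_le ?_
    have := optGauge_sq_le hn (hκ n hn).1.1 (hκ n hn).1.2 hx
    rwa [card_pairs, ← Nat.cast_choose_two] at this
  · rw [abs_le]; constructor <;> norm_num at * <;> linarith
  · obtain ⟨h1, h2⟩ := sqrt_three_sub_bounds
    rw [abs_le]; constructor <;> norm_num at * <;> nlinarith
  · obtain ⟨h1, h2⟩ := sqrt_three_sub_bounds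
    obtain ⟨h4, h5⟩ := sqrt_sqrt_three_bounds
    rw [abs_le, rpow_quarter]; constructor <;> norm_num at * <;> nlinarith
  · rw [abs_le]; constructor <;> norm_num at * <;> nlinarith
  · rw [cut_coefficient_eq, abs_le, neg_le_sub_iff_le_add, sub_le_iff_le_add]
    constructor
    · rw [← sub_le_iff_le_add]
      refine Real.le_sqrt_of_sq_le ?_
      norm_num at *
      linarith
    · rw [Real.sqrt_le_left (by norm_num)]
      norm_num at *
      linarith
  · exact isLittleO_natCast_of_tendsto tendsto_sqrt_three_mul_choose
  · rw [abs_le, neg_le_sub_iff_le_add, sub_le_iff_le_add]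
    constructor
    · rw [← sub_le_iff_le_add]
      exact Real.le_sqrt_of_sq_le (by norm_num)
    · rw [Real.sqrt_le_left (by norm_num)]
      norm_num
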